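/- Let $\mathbb U^*=\{\zeta\in\mathbb C:|\zeta|>1\}$, and let $\Sigma$ be the class of meromorphic functions in $\mathbb U^*$ that have an expansion $f(\zeta)=b\zeta+b_0+\frac{b_1}{\zeta}+\frac{b_2}{\zeta^2}+\cdots$ for all sufficiently large $|\zeta|$, with complex coefficients. A meromorphic function is called univalent in a set if it is injective there as a map into the Riemann sphere, and locally univalent in $\mathbb U^*$ if every point of $\mathbb U^*$ has a neighbourhood in which it is univalent. Write $S_f=\left(\frac{f''}{f'}\right)'-\frac12\left(\frac{f''}{f'}\right)^2$. Let $f,g\in\Sigma$ be locally univalent in $\mathbb U^*$. Suppose that there is an analytic function $h$ in $\mathbb U^*$ with $\operatorname{Re}h(\zeta)\ge\frac12$ for all $\zeta\in\mathbb U^*$ and with an expansion $h(\zeta)=1+\frac{h_2}{\zeta^2}+\frac{h_3}{\zeta^3}+\cdots$ near infinity, such that $$\left|\frac{1-h(\zeta)}{h(\zeta)}|\zeta|^2-(|\zeta|^2-1)\left[\frac{\zeta h'(\zeta)}{h(\zeta)}+\frac{\zeta g''(\zeta)}{g'(\zeta)}\right]+\frac12(|\zeta|^2-1)^2\frac{\zeta}{\overline{\zeta}}\,h(\zeta)\bigl(S_f(\zeta)-S_g(\zeta)\bigr)\right|\le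 1$$ for all $\zeta\in\mathbb U^*$ that are not poles of $f$ or $g$. Then $f$ is univalent in $\mathbb U^*$. -/

import Mathlib

/-- The exterior `U* = {ζ : |ζ| > 1}` of the closed unit disk in `ℂ`. -/
def exteriorDisk : Set ℂ := {ζ : ℂ | 1 < ‖ζ‖}

/-- `ζ` is a pole of the meromorphic function `f`. -/
def IsPoleAt (f : ℂ → ℂ) (ζ : ℂ) : Prop := meromorphicOrderAt f ζ < 0

open Classical in
/-- The value of a meromorphic function on the Riemann sphere `ℂ ∪ {∞}`: it is `∞` at the poles
and the ordinary value elsewhere. -/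
noncomputable def sphereValue (f : ℂ → ℂ) (ζ : ℂ) : OnePoint ℂ :=
  if IsPoleAt f ζ then OnePoint.infty else ((f ζ : ℂ) : OnePoint ℂ)

/-- Univalence on `s`: injectivity of the meromorphic function as a map into the Riemann sphere. -/
def UnivalentOn (f : ℂ → ℂ) (s : Set ℂ) : Prop := Set.InjOn (sphereValue f) s

/-- Local univalence on `s`: univalence on some neighbourhood of each point of `s`. -/
def LocallyUnivalentOn (f : ℂ → ℂ) (s : Set ℂ) : Prop :=
  ∀ ζ ∈ s, ∃ V : Set ℂ, IsOpen V ∧ ζ ∈ V ∧ UnivalentOn f V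

/-- The class `Σ` of meromorphic functions `f` in `U*` with an expansion
`f(ζ) = b ζ + b₀ + b₁ / ζ + b₂ / ζ² + ⋯` near infinity. `MeromorphicNFOn` says that `f` is
meromorphic in `U*` and carries its true value at every point which is not a pole (so that
removable singularities are removed); at a pole the `ℂ`-value is by convention `0`, and is
never used. -/
def ClassSigma (f : ℂ → ℂ) : Prop :=
  MeromorphicNFOn f exteriorDisk ∧
    ∃ (b : ℂ) (a : ℕ → ℂ), ∀ᶠ ζ in Bornology.cobounded ℂ,
      HasSum (fun n : ℕ => a n / ζ ^ n) (f ζ - b * ζ)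

/-- The function `h` has an expansion `h(ζ) = 1 + h₂ / ζ² + h₃ / ζ³ + ⋯` near infinity. -/
def HasUnitExpansion (h : ℂ → ℂ) : Prop :=
  ∃ c : ℕ → ℂ, c 0 = 1 ∧ c 1 = 0 ∧
    ∀ᶠ ζ in Bornology.cobounded ℂ, HasSum (fun n : ℕ => c n / ζ ^ n) (h ζ)

/-- The quotient `f'' / f'`. -/
noncomputable def preSchwarzian (f : ℂ → ℂ) (ζ : ℂ) : ℂ := deriv (deriv f) ζ / deriv f ζ

/-- The Schwarzian derivative `S_f = (f'' / f')' - (1/2) (f'' / f')²`. -/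
noncomputable def schwarzian (f : ℂ → ℂ) (ζ : ℂ) : ℂ :=
  deriv (preSchwarzian f) ζ - (1 / 2 : ℂ) * preSchwarzian f ζ ^ 2

/-! Put ζ = 1/z, F(z) = f(1/z), G(z) = g(1/z), k(z) = h(1/z) and γ = -z²G'. On a disc |z| < ρ < 1
the function F is a quotient v₁/v₂ of analytic functions with Wronskian v₁v₂' - v₁'v₂ = γ. Then F' =
-γ/v₂² and G' = -γ/z², and comparing Schwarzians gives ½z²(S_F - S_G)γ = z²(v₁'v₂'' - v₁''v₂') -
zγ'. So the criterion becomes a bound on an expression in v₁, v₂ and k.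

Deform F by Nᵢ(t, x) = vᵢ + (t² - 1)k(vᵢ - zvᵢ') at z = tx. At t = 1 the point [N₁ : N₂] is the
value F(x); at t = 0, after rescaling, the map is explicit and injective. In between, a curve x(t)
along which the value stays constant satisfies the Loewner equation dx/dt = xp/t with p = (1 -
x²Ψ)/(1 + x²Ψ), where Ψ(t, z) is quadratic in t² - 1 with coefficients analytic in z. The hypothesis
says |Ψ(|z|, z)| ≤ 1, and the maximum principle (`norm_quadratic_le_one`) extends this to |z| ≤ t ≤
1. Hence Re p > 0, level curves move inwards as t decreases, and two distinct points with a common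
value at t = 1 would force such a pair at t = 0 (`parallel_imp_eq_of_flow`).

The construction needs γ analytic and zero-free in the whole disc, although g may have poles and
nothing is assumed about local univalence at infinity. The inequality supplies both: a finite pole
of g would make its left side unbounded (`analyticAt_of_bound`), and its expansion at z = 0 leaves
only orders of F' and G' compatible with local univalence (`localPair_zero_of_bound`). Poles of F
are absorbed by the quotient representation, glued from local ones in `exists_global_pair`. -/

/-! ### Level curves and the continuity method -/

open Filter Topology in
theorem exists_implicit_curve {H : ℂ × ℂ → ℂ} {t₀ x₀ a b : ℂ}
    (hH : HasStrictFDerivAt H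
      (a • ContinuousLinearMap.fst ℂ ℂ ℂ + b • ContinuousLinearMap.snd ℂ ℂ ℂ) (t₀, x₀))
    (hb : b ≠ 0) (h0 : H (t₀, x₀) = 0) :
    ∃ φ : ℂ → ℂ, φ t₀ = x₀ ∧ (∀ᶠ t in 𝓝 t₀, H (t, φ t) = 0) ∧ HasDerivAt φ (-a / b) t₀ := by
  have hinv : ((a • ContinuousLinearMap.fst ℂ ℂ ℂ + b • ContinuousLinearMap.snd ℂ ℂ ℂ) ∘L
      ContinuousLinearMap.inr ℂ ℂ ℂ).IsInvertible := by
    refine ⟨ContinuousLinearEquiv.unitsEquivAut ℂ (Units.mk0 b hb), ?_⟩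
    ext
    simp
  have hd := (hH.hasStrictFDerivAt_implicitFunctionOfProdDomain hinv).hasFDerivAt.hasDerivAt
  have hev := hH.eventually_apply_implicitFunctionOfProdDomain hinv
  have hx : hH.implicitFunctionOfProdDomain hinv t₀ = x₀ :=
    (hH.eventually_apply_eq_iff_implicitFunctionOfProdDomain hinv).self_of_nhds.mp rfl
  set φ := hH.implicitFunctionOfProdDomain hinv
  set d := (-((a • ContinuousLinearMap.fst ℂ ℂ ℂ + b • ContinuousLinearMap.snd ℂ ℂ ℂ) ∘L
      ContinuousLinearMap.inr ℂ ℂ ℂ).inverse ∘L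
      ((a • ContinuousLinearMap.fst ℂ ℂ ℂ + b • ContinuousLinearMap.snd ℂ ℂ ℂ) ∘L
      ContinuousLinearMap.inl ℂ ℂ ℂ)) 1
  rw [h0] at hev
  refine ⟨φ, hx, hev, ?_⟩
  have h1 : HasDerivAt (fun t => H (t, φ t)) (a + b * d) t₀ := by
    have h2 : HasFDerivAt H (a • ContinuousLinearMap.fst ℂ ℂ ℂ +
        b • ContinuousLinearMap.snd ℂ ℂ ℂ) (t₀, φ t₀) := by rw [hx]; exact hH.hasFDerivAt
    have h3 := h2.comp_hasDerivAt t₀ ((hasDerivAt_id t₀).prodMk hd)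
    simpa using! h3
  have h2 : HasDerivAt (fun t => H (t, φ t)) 0 t₀ :=
    (hasDerivAt_const t₀ (0 : ℂ)).congr_of_eventuallyEq hev
  have h3 : a + b * d = 0 := h1.unique h2
  have : d = -a / b := by field_simp; linear_combination h3
  rwa [this] at hd

open Filter Topology in
theorem eventually_norm_lt_left {φ : ℂ → ℂ} {d : ℂ} {t₀ : ℝ} (hφ : HasDerivAt φ d t₀)
    (hd : 0 < ((starRingEnd ℂ) (φ t₀) * d).re) :
    ∀ᶠ t : ℝ in 𝓝[<] t₀, ‖φ t‖ < ‖φ t₀‖ := by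
  have h1 : HasDerivAt (fun t : ℝ => φ t) d t₀ := hφ.comp_ofReal
  have h2 := h1.norm_sq
  have hpos : 0 < 2 * inner ℝ (φ t₀) d := by
    rw [Complex.inner]
    have : 0 < ((starRingEnd ℂ) (φ t₀) * d).re := hd
    rw [mul_comm]; simp at this ⊢; linarith
  have h3 := hasDerivAt_iff_tendsto_slope.mp h2
  have h4 : ∀ᶠ t : ℝ in 𝓝[<] t₀, 0 < slope (fun t : ℝ => ‖φ t‖ ^ 2) t₀ t :=
    (h3.mono_left (nhdsWithin_mono _ (fun x hx => ne_of_lt hx))).eventually (lt_mem_nhds hpos)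
  filter_upwards [h4, self_mem_nhdsWithin] with t ht htl
  rw [slope_def_field, div_pos_iff] at ht
  have htl' : t < t₀ := htl
  rcases ht with ht | ht
  · linarith [ht.2]
  · exact lt_of_pow_lt_pow_left₀ 2 (norm_nonneg _) (by linarith [ht.1])

open Filter Topology in
/-- The continuity method for a family of maps into the projective line, given by homogeneous
coordinates `(t * M₁, M₂)`, which is driven towards the origin as the parameter decreases. -/
theorem parallel_imp_eq_of_flow {r : ℝ} (hr : 0 < r) {M₁ M₂ A₁ B₁ A₂ B₂ : ℂ × ℂ → ℂ}
    (h₁ : ∀ t : ℝ, 0 ≤ t → t ≤ 1 → ∀ x : ℂ, ‖x‖ ≤ r → HasStrictFDerivAt M₁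
      (A₁ (t, x) • ContinuousLinearMap.fst ℂ ℂ ℂ + B₁ (t, x) • ContinuousLinearMap.snd ℂ ℂ ℂ)
      ((t : ℂ), x))
    (h₂ : ∀ t : ℝ, 0 ≤ t → t ≤ 1 → ∀ x : ℂ, ‖x‖ ≤ r → HasStrictFDerivAt M₂
      (A₂ (t, x) • ContinuousLinearMap.fst ℂ ℂ ℂ + B₂ (t, x) • ContinuousLinearMap.snd ℂ ℂ ℂ)
      ((t : ℂ), x))
    (hJ : ∀ t : ℝ, 0 ≤ t → t ≤ 1 → ∀ x : ℂ, ‖x‖ ≤ r →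
      M₁ (t, x) * B₂ (t, x) - M₂ (t, x) * B₁ (t, x) ≠ 0)
    (h0 : ∀ x y : ℂ, ‖x‖ ≤ r → ‖y‖ ≤ r →
      M₁ (0, x) * M₂ (0, y) = M₁ (0, y) * M₂ (0, x) → x = y)
    (hflow : ∀ t : ℝ, 0 < t → t ≤ 1 → ∀ x : ℂ, ‖x‖ ≤ r → ∃ p : ℂ, 0 < p.re ∧
      t * (M₁ (t, x) * A₂ (t, x) - M₂ (t, x) * A₁ (t, x)) - M₁ (t, x) * M₂ (t, x) =
        -(x * p) * (M₁ (t, x) * B₂ (t, x) - M₂ (t, x) * B₁ (t, x)))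
    {x y : ℂ} (hx : ‖x‖ ≤ r) (hy : ‖y‖ ≤ r)
    (hxy : M₁ (1, x) * M₂ (1, y) = M₁ (1, y) * M₂ (1, x)) : x = y := by
  by_contra hne
  -- The parameters at which injectivity on the closed disc fails. It will contain its infimum,
  -- which can be neither zero (by `h0`) nor positive (by the flow).
  let T : Set ℝ := {t | 0 ≤ t ∧ t ≤ 1 ∧ ∃ x y : ℂ, ‖x‖ ≤ r ∧ ‖y‖ ≤ r ∧ x ≠ y ∧
    M₁ (t, x) * M₂ (t, y) = M₁ (t, y) * M₂ (t, x)}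
  have hT1 : (1 : ℝ) ∈ T := ⟨zero_le_one, le_rfl, x, y, hx, hy, hne, by simpa using hxy⟩
  have hTb : BddBelow T := ⟨0, fun t ht => ht.1⟩
  have hT : sInf T ∈ T := by
    obtain ⟨s, -, hs, hsT⟩ := exists_seq_tendsto_sInf ⟨1, hT1⟩ hTb
    choose hs0 hs1 u v hu hv huv hpar using hsT
    have hc0 : 0 ≤ sInf T := ge_of_tendsto' hs hs0
    have hc1 : sInf T ≤ 1 := le_of_tendsto' hs hs1
    set t₀ := sInf T
    have hK : IsCompact (Metric.closedBall (0 : ℂ) r ×ˢ Metric.closedBall (0 : ℂ) r) :=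
      (isCompact_closedBall _ _).prod (isCompact_closedBall _ _)
    obtain ⟨⟨a, b⟩, hab, ψ, hψ, hlim⟩ := hK.tendsto_subseq (x := fun n => (u n, v n))
      (fun n => ⟨by simpa using hu n, by simpa using hv n⟩)
    have ha : ‖a‖ ≤ r := by simpa using hab.1
    have hb : ‖b‖ ≤ r := by simpa using hab.2
    have hua : Tendsto (fun n => u (ψ n)) atTop (𝓝 a) := (continuous_fst.tendsto _).comp hlim
    have hvb : Tendsto (fun n => v (ψ n)) atTop (𝓝 b) := (continuous_snd.tendsto _).comp hlim
    have hst : Tendsto (fun n => ((s (ψ n) : ℝ) : ℂ)) atTop (𝓝 (t₀ : ℂ)) :=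
      (Complex.continuous_ofReal.tendsto _).comp (hs.comp hψ.tendsto_atTop)
    have hpu : Tendsto (fun n => ((s (ψ n) : ℂ), u (ψ n))) atTop (𝓝 ((t₀ : ℂ), a)) :=
      hst.prodMk_nhds hua
    have hpv : Tendsto (fun n => ((s (ψ n) : ℂ), v (ψ n))) atTop (𝓝 ((t₀ : ℂ), b)) :=
      hst.prodMk_nhds hvb
    have c1 := fun {n : ℂ} (hn : ‖n‖ ≤ r) => (h₁ t₀ hc0 hc1 n hn).continuousAt
    have c2 := fun {n : ℂ} (hn : ‖n‖ ≤ r) => (h₂ t₀ hc0 hc1 n hn).continuousAt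
    by_cases hab' : a = b
    · subst hab'
      exfalso
      -- If the two points merge in the limit, difference quotients at equal parameter tend to the
      -- x-derivatives, so the parallel relation passes to a vanishing Jacobian, against `hJ`.
      have key : ∀ {M A B : ℂ × ℂ → ℂ}, HasStrictFDerivAt M (A (t₀, a) •
          ContinuousLinearMap.fst ℂ ℂ ℂ + B (t₀, a) • ContinuousLinearMap.snd ℂ ℂ ℂ) ((t₀ : ℂ), a) →
          Tendsto (fun n => (M (s (ψ n), u (ψ n)) - M (s (ψ n), v (ψ n))) / (u (ψ n) - v (ψ n)))
            atTop (𝓝 (B (t₀, a))) := by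
        intro M A B hM
        have h := hM.isLittleO.comp_tendsto (hpu.prodMk_nhds hpv)
        have h' : (fun n => M (s (ψ n), u (ψ n)) - M (s (ψ n), v (ψ n)) -
            B (t₀, a) * (u (ψ n) - v (ψ n))) =o[atTop] (fun n => u (ψ n) - v (ψ n)) := by
          refine (h.congr_left (fun n => ?_)).trans_isBigO (Asymptotics.isBigO_of_le _ fun n => ?_)
          · simp
          · simp [Prod.norm_def]
        have h3 := h'.tendsto_div_nhds_zero.add_const (B (t₀, a))
        rw [zero_add] at h3
        refine h3.congr fun n => ?_
        have : u (ψ n) - v (ψ n) ≠ 0 := sub_ne_zero.mpr (huv _)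
        field_simp
        ring
      have k1 := key (h₁ t₀ hc0 hc1 a ha)
      have k2 := key (h₂ t₀ hc0 hc1 a ha)
      have e := ((((c1 ha).tendsto.comp hpv).mul k2).sub (((c2 ha).tendsto.comp hpv).mul k1))
      refine hJ t₀ hc0 hc1 a ha (tendsto_nhds_unique e ?_)
      refine tendsto_const_nhds.congr fun n => ?_
      have : u (ψ n) - v (ψ n) ≠ 0 := sub_ne_zero.mpr (huv _)
      simp only [Function.comp_apply]
      field_simp
      linear_combination hpar (ψ n)
    · refine ⟨hc0, hc1, a, b, ha, hb, hab', ?_⟩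
      refine tendsto_nhds_unique (((c1 ha).tendsto.comp hpu).mul ((c2 hb).tendsto.comp hpv)) ?_
      refine (((c1 hb).tendsto.comp hpv).mul ((c2 ha).tendsto.comp hpu)).congr fun n => ?_
      exact (hpar (ψ n)).symm
  obtain ⟨ht0, ht1, a, b, ha, hb, hab, hpar⟩ := hT
  have hmin : ∀ t ∈ T, sInf T ≤ t := fun t ht => csInf_le hTb ht
  set t₀ := sInf T
  have htpos : 0 < t₀ := by
    rcases ht0.eq_or_lt with h | h
    · rw [← h] at hpar
      exact absurd (h0 a b ha hb (by simpa using hpar)) hab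
    · exact h
  have htc : (t₀ : ℂ) ≠ 0 := by exact_mod_cast htpos.ne'
  -- `α`, `β` are homogeneous coordinates of the common value
  have move : ∀ {α β l z : ℂ}, ‖z‖ ≤ r → l ≠ 0 → α = l * (t₀ * M₁ (t₀, z)) →
      β = l * M₂ (t₀, z) → ∃ φ : ℂ → ℂ, φ t₀ = z ∧ ContinuousAt φ t₀ ∧
        (∀ᶠ t in 𝓝 (t₀ : ℂ), β * (t * M₁ (t, φ t)) = α * M₂ (t, φ t)) ∧
        ∀ᶠ t : ℝ in 𝓝[<] t₀, ‖φ t‖ ≤ r := by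
    intro α β l z hz hl hα hβ
    have d1 := h₁ t₀ ht0 ht1 z hz
    have d2 := h₂ t₀ ht0 ht1 z hz
    obtain ⟨p, hp, hpe⟩ := hflow t₀ htpos ht1 z hz
    have hJz := hJ t₀ ht0 ht1 z hz
    have dfst : HasStrictFDerivAt (fun q : ℂ × ℂ => q.1) (ContinuousLinearMap.fst ℂ ℂ ℂ)
      ((t₀ : ℂ), z) := hasStrictFDerivAt_fst
    have dH := ((dfst.mul d1).const_mul β).sub (d2.const_mul α)
    set a' := β * (M₁ (t₀, z) + t₀ * A₁ (t₀, z)) - α * A₂ (t₀, z) with ha'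
    set b' := β * (t₀ * B₁ (t₀, z)) - α * B₂ (t₀, z) with hb'
    have dH' : HasStrictFDerivAt (fun q : ℂ × ℂ => β * (q.1 * M₁ q) - α * M₂ q)
        (a' • ContinuousLinearMap.fst ℂ ℂ ℂ + b' • ContinuousLinearMap.snd ℂ ℂ ℂ)
        ((t₀ : ℂ), z) := by
      refine dH.congr_fderiv ?_
      ext <;> simp [ha', hb']
      ring
    have hb'e : b' = -(l * t₀) * (M₁ (t₀, z) * B₂ (t₀, z) - M₂ (t₀, z) * B₁ (t₀, z)) := by
      rw [hb', hα, hβ]; ring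
    have hb'0 : b' ≠ 0 := by
      rw [hb'e]; exact mul_ne_zero (neg_ne_zero.mpr (mul_ne_zero hl htc)) hJz
    obtain ⟨φ, hφ0, hφ, hdφ⟩ := exists_implicit_curve dH' hb'0 (by simp only [hα, hβ]; ring)
    -- The Loewner equation for the level curve, φ' = φp/t, at t₀.
    have hdd : -a' / b' = z * p / t₀ := by
      have : a' = -l * (-(z * p) * (M₁ (t₀, z) * B₂ (t₀, z) - M₂ (t₀, z) * B₁ (t₀, z))) := by
        rw [ha', hα, hβ, ← hpe]; ring
      rw [this, hb'e]
      field_simp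
    rw [hdd] at hdφ
    refine ⟨φ, hφ0, hdφ.continuousAt, hφ.mono fun t ht => sub_eq_zero.mp ht, ?_⟩
    -- An interior point stays in the disc by continuity; only on |z| = r is the sign of Re p
    -- needed, to push the curve inwards as t decreases.
    rcases hz.lt_or_eq with hlt | heq
    · have hc : ContinuousAt (fun t : ℝ => ‖φ t‖) t₀ :=
        (hdφ.comp_ofReal).continuousAt.norm
      have : ∀ᶠ t : ℝ in 𝓝 t₀, ‖φ t‖ < r := hc.eventually (gt_mem_nhds (by simpa [hφ0] using hlt))
      exact (this.filter_mono nhdsWithin_le_nhds).mono fun t ht => ht.le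
    · have := eventually_norm_lt_left hdφ (by
        rw [hφ0]
        have : (starRingEnd ℂ) z * (z * p / t₀) = ((‖z‖ ^ 2 / t₀ : ℝ) : ℂ) * p := by
          have h := Complex.conj_mul' z
          push_cast
          rw [← h]; ring
        rw [this, Complex.re_ofReal_mul, heq]
        positivity)
      exact this.mono fun t ht => by rw [hφ0, heq] at ht; exact ht.le
  have hb0 : M₁ (t₀, b) ≠ 0 ∨ M₂ (t₀, b) ≠ 0 := by
    by_contra! h
    exact hJ t₀ ht0 ht1 b hb (by rw [h.1, h.2]; ring)
  have ha0 : M₁ (t₀, a) ≠ 0 ∨ M₂ (t₀, a) ≠ 0 := by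
    by_contra! h
    exact hJ t₀ ht0 ht1 a ha (by rw [h.1, h.2]; ring)
  obtain ⟨l, hl, hl1, hl2⟩ : ∃ l : ℂ, l ≠ 0 ∧ M₁ (t₀, a) = l * M₁ (t₀, b) ∧
      M₂ (t₀, a) = l * M₂ (t₀, b) := by
    rcases hb0 with h | h
    · refine ⟨M₁ (t₀, a) / M₁ (t₀, b), ?_, by field_simp, ?_⟩
      · intro h'
        have h1 : M₁ (t₀, a) = 0 := by simpa [h] using h'
        rw [h1, zero_mul] at hpar
        have h2 : M₂ (t₀, a) = 0 := by simpa [h] using hpar.symm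
        simp [h1, h2] at ha0
      · field_simp; linear_combination -hpar
    · refine ⟨M₂ (t₀, a) / M₂ (t₀, b), ?_, ?_, by field_simp⟩
      · intro h'
        have h1 : M₂ (t₀, a) = 0 := by simpa [h] using h'
        rw [h1, mul_zero] at hpar
        have h2 : M₁ (t₀, a) = 0 := by simpa [h] using hpar
        simp [h1, h2] at ha0
      · field_simp; linear_combination hpar
  obtain ⟨φ, hφa, hφc, hφ, hφr⟩ := move (α := t₀ * M₁ (t₀, a)) (β := M₂ (t₀, a)) (l := 1) ha
    one_ne_zero (by ring) (by ring)
  obtain ⟨θ, hθb, hθc, hθ, hθr⟩ := move (α := t₀ * M₁ (t₀, a)) (β := M₂ (t₀, a)) hb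
    hl (by rw [hl1]; ring) hl2
  have hφθ : ∀ᶠ t in 𝓝 (t₀ : ℂ), φ t ≠ θ t :=
    ((hφc.sub hθc).eventually_ne (by
      simpa only [Pi.sub_apply, hφa, hθb] using sub_ne_zero.mpr hab)).mono
        fun t ht => sub_ne_zero.mp ht
  have toR : ∀ {P : ℂ → Prop}, (∀ᶠ t in 𝓝 (t₀ : ℂ), P t) → ∀ᶠ t : ℝ in 𝓝[<] t₀, P t :=
    fun h => ((Complex.continuous_ofReal.tendsto t₀).eventually h).filter_mono nhdsWithin_le_nhds
  have hgt : ∀ᶠ t : ℝ in 𝓝[<] t₀, 0 < t :=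
    (lt_mem_nhds htpos).filter_mono nhdsWithin_le_nhds
  obtain ⟨t, e1, e2, e3, e4, e5, e6, e7⟩ := ((toR hφ).and ((toR hθ).and ((toR hφθ).and
    (hφr.and (hθr.and (hgt.and self_mem_nhdsWithin)))))).exists
  have htT : t ∈ T := by
    refine ⟨e6.le, (le_of_lt e7).trans ht1, φ t, θ t, e4, e5, e3, ?_⟩
    have ht' : (t : ℂ) ≠ 0 := by exact_mod_cast e6.ne'
    -- Both curves carry values proportional to the same fixed vector; eliminating a nonzero
    -- coordinate of it makes the two values parallel to each other.
    rcases ha0 with h | h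
    · have : (t₀ * M₁ (t₀, a)) * (t * (M₁ (t, φ t) * M₂ (t, θ t) - M₁ (t, θ t) * M₂ (t, φ t)))
          = 0 := by
        linear_combination (-t * M₁ (t, φ t)) * e2 + (t * M₁ (t, θ t)) * e1
      have := (mul_eq_zero.mp this).resolve_left (mul_ne_zero htc h)
      exact sub_eq_zero.mp ((mul_eq_zero.mp this).resolve_left ht')
    · have : M₂ (t₀, a) * (t * (M₁ (t, φ t) * M₂ (t, θ t) - M₁ (t, θ t) * M₂ (t, φ t)))
          = 0 := by
        linear_combination M₂ (t, θ t) * e1 - M₂ (t, φ t) * e2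
      have := (mul_eq_zero.mp this).resolve_left h
      exact sub_eq_zero.mp ((mul_eq_zero.mp this).resolve_left ht')
  exact absurd (hmin t htT) (not_le.mpr e7)

/-! ### The Loewner-type family built from v₁, v₂ and k -/

theorem HasStrictDerivAt.hasStrictFDerivAt_comp_mul {f : ℂ → ℂ} {f' t x : ℂ}
    (hf : HasStrictDerivAt f f' (t * x)) :
    HasStrictFDerivAt (fun q : ℂ × ℂ => f (q.1 * q.2))
      ((x * f') • ContinuousLinearMap.fst ℂ ℂ ℂ + (t * f') • ContinuousLinearMap.snd ℂ ℂ ℂ)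
      (t, x) := by
  have h1 : HasStrictFDerivAt (fun q : ℂ × ℂ => q.1) (ContinuousLinearMap.fst ℂ ℂ ℂ) (t, x) :=
    hasStrictFDerivAt_fst
  have h2 : HasStrictFDerivAt (fun q : ℂ × ℂ => q.2) (ContinuousLinearMap.snd ℂ ℂ ℂ) (t, x) :=
    hasStrictFDerivAt_snd
  have h3 := hf.comp_hasStrictFDerivAt (t, x) (h1.mul h2)
  refine h3.congr_fderiv ?_
  ext <;> simp <;> ring

/-- The family `Nᵢ = vᵢ + (t² - 1) k (vᵢ - z vᵢ')` at `z = t x`, for `v₁ = 1 + z² c`,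
`v₂ = g₀ z + z³ w`, `k = 1 + z² κ`, satisfies the hypotheses of the continuity method as soon as
the Loewner quotient, encoded by `Ψ`, is bounded by `1`. -/
theorem parallel_imp_eq_of_bound {ρ r : ℝ} (hr : 0 < r) (hrρ : r < ρ) (hρ : ρ ≤ 1)
    {c κ w : ℂ → ℂ} {g₀ : ℂ} (hg₀ : g₀ ≠ 0)
    (hc : AnalyticOnNhd ℂ c (Metric.ball 0 ρ)) (hκ : AnalyticOnNhd ℂ κ (Metric.ball 0 ρ))
    (hw : AnalyticOnNhd ℂ w (Metric.ball 0 ρ))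
    {k γ G Q : ℂ → ℂ} (hk : ∀ z, k z = 1 + z ^ 2 * κ z)
    (hγ : ∀ z, γ z = (1 + z ^ 2 * c z) * (g₀ + 3 * z ^ 2 * w z + z ^ 3 * deriv w z) -
      (2 * z * c z + z ^ 2 * deriv c z) * (g₀ * z + z ^ 3 * w z))
    (hG : ∀ z, G z = (1 + z ^ 2 * c z) * (6 * w z + 6 * z * deriv w z + z ^ 2 * deriv (deriv w) z) -
      (2 * c z + 4 * z * deriv c z + z ^ 2 * deriv (deriv c) z) * (g₀ + z ^ 2 * w z))
    (hQ : ∀ z, Q z = (2 * z * c z + z ^ 2 * deriv c z) *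
        (6 * z * w z + 6 * z ^ 2 * deriv w z + z ^ 3 * deriv (deriv w) z) -
      (2 * c z + 4 * z * deriv c z + z ^ 2 * deriv (deriv c) z) *
        (g₀ + 3 * z ^ 2 * w z + z ^ 3 * deriv w z))
    (hk0 : ∀ z, ‖z‖ < ρ → k z ≠ 0) (hγ0 : ∀ z, ‖z‖ < ρ → γ z ≠ 0)
    {Ψ : ℝ → ℂ → ℂ}
    (hΨ : ∀ t : ℝ, 0 ≤ t → t ≤ 1 → ∀ z, ‖z‖ < ρ → Ψ t z * (k z * γ z) = -κ z * γ z -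
      ((t : ℂ) ^ 2 - 1) * ((2 * κ z + z * deriv κ z) * γ z + k z * G z) +
      ((t : ℂ) ^ 2 - 1) ^ 2 * k z ^ 2 * (Q z - G z))
    (hΨ1 : ∀ t : ℝ, 0 ≤ t → t ≤ 1 → ∀ z, ‖z‖ < ρ → ‖z‖ ≤ t → ‖Ψ t z‖ ≤ 1)
    {x y : ℂ} (hx : ‖x‖ ≤ r) (hy : ‖y‖ ≤ r)
    (hxy : (1 + x ^ 2 * c x) * (g₀ * y + y ^ 3 * w y) =
      (1 + y ^ 2 * c y) * (g₀ * x + x ^ 3 * w x)) : x = y := by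
  have hr1 : r < 1 := hrρ.trans_le hρ
  have hkey : ∀ (t : ℝ), 0 ≤ t → t ≤ 1 → ∀ x : ℂ, ‖x‖ ≤ r →
      ‖x ^ 2 * Ψ t (t * x)‖ < 1 ∧ ‖(t : ℂ) * x‖ < ρ := by
    intro t h0 h1 x hx
    have e1 : ‖(t : ℂ) * x‖ = t * ‖x‖ := by
      rw [norm_mul, Complex.norm_real, Real.norm_of_nonneg h0]
    have e2 : ‖(t : ℂ) * x‖ < ρ := by
      rw [e1]
      calc t * ‖x‖ ≤ 1 * r := by gcongr
        _ < ρ := by linarith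
    refine ⟨?_, e2⟩
    have e3 := hΨ1 t h0 h1 _ e2 (by rw [e1]; nlinarith [norm_nonneg x])
    rw [norm_mul, norm_pow]
    calc ‖x‖ ^ 2 * ‖Ψ t (t * x)‖ ≤ r ^ 2 * 1 := by gcongr
      _ < 1 := by nlinarith
  -- `l` is v₁ - zv₁'. Each primed letter is the derivative of the unprimed one.
  let l : ℂ → ℂ := fun z => 1 - z ^ 2 * c z - z ^ 3 * deriv c z
  let l' : ℂ → ℂ := fun z => -2 * z * c z - 4 * z ^ 2 * deriv c z - z ^ 3 * deriv (deriv c) z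
  let k' : ℂ → ℂ := fun z => 2 * z * κ z + z ^ 2 * deriv κ z
  let m : ℂ → ℂ := fun z => 2 * c z + z * deriv c z - κ z * l z
  let m' : ℂ → ℂ := fun z =>
    3 * deriv c z + z * deriv (deriv c) z - deriv κ z * l z - κ z * l' z
  let E : ℂ → ℂ := fun z => k z * l z
  let E' : ℂ → ℂ := fun z => k' z * l z + k z * l' z
  let u : ℂ → ℂ := fun z => g₀ + z ^ 2 * w z
  let u' : ℂ → ℂ := fun z => 2 * z * w z + z ^ 2 * deriv w z
  let n : ℂ → ℂ := fun z => k z * (2 * z ^ 2 * w z + z ^ 3 * deriv w z)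
  let n' : ℂ → ℂ := fun z => k' z * (2 * z ^ 2 * w z + z ^ 3 * deriv w z) +
    k z * (4 * z * w z + 5 * z ^ 2 * deriv w z + z ^ 3 * deriv (deriv w) z)
  have sd : ∀ {f : ℂ → ℂ}, AnalyticOnNhd ℂ f (Metric.ball 0 ρ) → ∀ z, ‖z‖ < ρ →
      HasStrictDerivAt f (deriv f z) z :=
    fun hf z hz => (hf z (by simpa using hz)).hasStrictDerivAt
  have spow : ∀ (j : ℕ) (z : ℂ), HasStrictDerivAt (fun z : ℂ => z ^ j) (j * z ^ (j - 1)) z :=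
    fun j z => hasStrictDerivAt_pow j z
  have sid : ∀ z : ℂ, HasStrictDerivAt (fun z : ℂ => z) 1 z := fun z => hasStrictDerivAt_id z
  have hl : ∀ z, ‖z‖ < ρ → HasStrictDerivAt l (l' z) z := by
    intro z hz
    refine (((((spow 2 z).mul (sd hc z hz)).const_sub 1).sub
      ((spow 3 z).mul (sd hc.deriv z hz)))).congr_deriv ?_
    simp only [l']; push_cast; ring
  have hk' : ∀ z, ‖z‖ < ρ → HasStrictDerivAt k (k' z) z := by
    intro z hz
    rw [show k = fun z => 1 + z ^ 2 * κ z from funext hk]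
    refine (((spow 2 z).mul (sd hκ z hz)).const_add 1).congr_deriv ?_
    simp only [k']; push_cast; ring
  have hm : ∀ z, ‖z‖ < ρ → HasStrictDerivAt m (m' z) z := by
    intro z hz
    refine ((((sd hc z hz).const_mul 2).add ((sid z).mul (sd hc.deriv z hz))).sub
      ((sd hκ z hz).mul (hl z hz))).congr_deriv ?_
    simp only [m']; ring
  have hE : ∀ z, ‖z‖ < ρ → HasStrictDerivAt E (E' z) z :=
    fun z hz => (hk' z hz).mul (hl z hz)
  have hu : ∀ z, ‖z‖ < ρ → HasStrictDerivAt u (u' z) z := by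
    intro z hz
    refine (((spow 2 z).mul (sd hw z hz)).const_add g₀).congr_deriv ?_
    simp only [u']; push_cast; ring
  have hn : ∀ z, ‖z‖ < ρ → HasStrictDerivAt n (n' z) z := by
    intro z hz
    refine ((hk' z hz).mul ((((spow 2 z).const_mul 2).mul (sd hw z hz)).add
      ((spow 3 z).mul (sd hw.deriv z hz)))).congr_deriv ?_
    simp only [n', Pi.add_apply, Pi.mul_apply]; push_cast; ring
  -- With z = tx one has N₁ = z²m + t²E = t²M₁ and N₂ = tM₂. Thus [N₁ : N₂] = [tM₁ : M₂], and the
  -- degeneration at t = 0 has been divided out.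
  let M₁ : ℂ × ℂ → ℂ := fun q => q.2 ^ 2 * m (q.1 * q.2) + E (q.1 * q.2)
  let A₁ : ℂ × ℂ → ℂ := fun q => q.2 ^ 3 * m' (q.1 * q.2) + q.2 * E' (q.1 * q.2)
  let B₁ : ℂ × ℂ → ℂ := fun q =>
    2 * q.2 * m (q.1 * q.2) + q.2 ^ 2 * q.1 * m' (q.1 * q.2) + q.1 * E' (q.1 * q.2)
  let M₂ : ℂ × ℂ → ℂ := fun q => q.2 * (u (q.1 * q.2) - (q.1 ^ 2 - 1) * n (q.1 * q.2))
  let A₂ : ℂ × ℂ → ℂ := fun q => q.2 * (q.2 * u' (q.1 * q.2) - 2 * q.1 * n (q.1 * q.2) -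
    (q.1 ^ 2 - 1) * q.2 * n' (q.1 * q.2))
  let B₂ : ℂ × ℂ → ℂ := fun q => u (q.1 * q.2) - (q.1 ^ 2 - 1) * n (q.1 * q.2) +
    q.2 * q.1 * (u' (q.1 * q.2) - (q.1 ^ 2 - 1) * n' (q.1 * q.2))
  have dfst : ∀ q : ℂ × ℂ, HasStrictFDerivAt (fun q : ℂ × ℂ => q.1)
    (ContinuousLinearMap.fst ℂ ℂ ℂ) q := fun q => hasStrictFDerivAt_fst
  have dsnd : ∀ q : ℂ × ℂ, HasStrictFDerivAt (fun q : ℂ × ℂ => q.2)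
    (ContinuousLinearMap.snd ℂ ℂ ℂ) q := fun q => hasStrictFDerivAt_snd
  -- The Jacobian is a zero-free factor times 1 + x²Ψ, and |x²Ψ| < 1 keeps it away from zero.
  have hJ : ∀ t : ℝ, 0 ≤ t → t ≤ 1 → ∀ x : ℂ, ‖x‖ ≤ r →
      M₁ (t, x) * B₂ (t, x) - M₂ (t, x) * B₁ (t, x) =
        k (t * x) * γ (t * x) * (1 + x ^ 2 * Ψ t (t * x)) := by
    intro t ht0 ht1 x hx
    have h := hΨ t ht0 ht1 (t * x) (hkey t ht0 ht1 x hx).2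
    have e : k (t * x) * γ (t * x) * (1 + x ^ 2 * Ψ t (t * x)) = k (t * x) * γ (t * x) +
      x ^ 2 * (Ψ t (t * x) * (k (t * x) * γ (t * x))) := by ring
    rw [e, h]
    simp only [M₁, M₂, B₁, B₂, E, E', m, m', u, u', n, n', k', l, l', hγ, hG, hQ, hk]
    ring
  have hp1 : ∀ e : ℂ, ‖e‖ < 1 → 1 + e ≠ 0 := by
    intro e he h
    rw [show e = -1 by linear_combination h] at he
    simp at he
  refine parallel_imp_eq_of_flow hr (M₁ := M₁) (M₂ := M₂) (A₁ := A₁) (B₁ := B₁) (A₂ := A₂)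
    (B₂ := B₂) ?_ ?_ ?_ ?_ ?_ hx hy ?_
  · intro t ht0 ht1 x hx
    have hz := (hkey t ht0 ht1 x hx).2
    refine ((((dsnd (↑t, x)).pow 2).mul (hm _ hz).hasStrictFDerivAt_comp_mul).add
      (hE _ hz).hasStrictFDerivAt_comp_mul).congr_fderiv ?_
    ext <;> simp [A₁, B₁] <;> ring
  · intro t ht0 ht1 x hx
    have hz := (hkey t ht0 ht1 x hx).2
    refine ((dsnd (↑t, x)).mul ((hu _ hz).hasStrictFDerivAt_comp_mul.sub
      ((((dfst (↑t, x)).pow 2).sub_const 1).mul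
        (hn _ hz).hasStrictFDerivAt_comp_mul))).congr_fderiv ?_
    ext <;> simp [A₂, B₂, -mul_eq_mul_left_iff, -mul_eq_mul_right_iff] <;> ring
  · intro t ht0 ht1 x hx
    have hz := (hkey t ht0 ht1 x hx)
    rw [hJ t ht0 ht1 x hx]
    exact mul_ne_zero (mul_ne_zero (hk0 _ hz.2) (hγ0 _ hz.2)) (hp1 _ hz.1)
  -- At t = 0 the coordinates are 1 + sx² and g₀x with s = 2c(0) - κ(0) = -Ψ(0, 0). The cross
  -- product factors as g₀(y - x)(1 - sxy), and |s| ≤ 1 makes the last factor nonzero.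
  · intro x y hx hy h
    have hρ0 : ‖(0 : ℂ)‖ < ρ := by simpa using hr.trans hrρ
    have h1 := hΨ1 0 le_rfl zero_le_one 0 hρ0 (by simp)
    have h2 := hΨ 0 le_rfl zero_le_one 0 hρ0
    have h3 : Ψ 0 0 = -(2 * c 0 - κ 0) := by
      simp only [hk, hγ, hG, hQ] at h2
      norm_num at h2
      apply mul_right_cancel₀ hg₀
      linear_combination h2
    rw [h3, norm_neg] at h1
    simp only [M₁, M₂, m, E, l, u, n, hk] at h
    norm_num at h
    have h4 : g₀ * ((y - x) * (1 + -((2 * c 0 - κ 0) * (x * y)))) = 0 := by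
      linear_combination h
    have h5 := (mul_eq_zero.mp h4).resolve_left hg₀
    have h6 : ‖-((2 * c 0 - κ 0) * (x * y))‖ < 1 := by
      rw [norm_neg, norm_mul, norm_mul]
      calc ‖2 * c 0 - κ 0‖ * (‖x‖ * ‖y‖) ≤ 1 * (r * r) := by gcongr
        _ < 1 := by nlinarith
    exact (sub_eq_zero.mp ((mul_eq_zero.mp h5).resolve_right (hp1 _ h6))).symm
  · intro t ht0 ht1 x hx
    have hz := hkey t ht0.le ht1 x hx
    have h := hΨ t ht0.le ht1 (t * x) hz.2
    set e := x ^ 2 * Ψ t (t * x) with he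
    have hne := hp1 e hz.1
    -- The Cayley transform sends |e| < 1 into the right half-plane.
    refine ⟨(1 - e) / (1 + e), ?_, ?_⟩
    · rw [Complex.div_re, ← add_div]
      apply div_pos
      · have h1 : Complex.normSq e < 1 := by
          rw [Complex.normSq_eq_norm_sq]; nlinarith [norm_nonneg e, hz.1]
        rw [Complex.normSq_apply] at h1
        simp
        nlinarith
      · exact Complex.normSq_pos.mpr hne
    · rw [hJ t ht0.le ht1 x hx, ← he]
      have e1 : -(x * ((1 - e) / (1 + e))) * (k (t * x) * γ (t * x) * (1 + e)) =
          -x * (k (t * x) * γ (t * x) - x ^ 2 * (Ψ t (t * x) * (k (t * x) * γ (t * x)))) := by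
        have h2 : (1 - e) / (1 + e) * (1 + e) = 1 - e := div_mul_cancel₀ _ hne
        linear_combination (-x * k (t * x) * γ (t * x)) * h2 + (x * k (t * x) * γ (t * x)) * he
      rw [e1, h]
      simp only [M₁, M₂, A₁, A₂, E, E', m, m', u, u', n, n', k', l, l', hγ, hG, hQ, hk]
      ring
  · simp only [M₁, M₂, m, E, l, u, n, hk]
    simp only [one_mul]
    linear_combination hxy

/-! ### From the pointwise bound to univalence of v₁/v₂ -/

theorem exists_eq_sq_mul {s : Set ℂ} (hs : IsOpen s) (h0 : (0 : ℂ) ∈ s) {f : ℂ → ℂ}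
    (hf : AnalyticOnNhd ℂ f s) (hf0 : f 0 = 0) (hf1 : deriv f 0 = 0) :
    ∃ g : ℂ → ℂ, AnalyticOnNhd ℂ g s ∧ ∀ z, f z = z ^ 2 * g z := by
  have hn : s ∈ nhds (0 : ℂ) := hs.mem_nhds h0
  refine ⟨dslope (dslope f 0) 0, DifferentiableOn.analyticOnNhd
    ((Complex.differentiableOn_dslope hn).mpr
      ((Complex.differentiableOn_dslope hn).mpr hf.differentiableOn)) hs, fun z => ?_⟩
  have h1 := sub_smul_dslope f 0 z
  have h2 := sub_smul_dslope (dslope f 0) 0 z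
  simp only [sub_zero, smul_eq_mul, dslope_same, hf0, hf1] at h1 h2
  rw [← h1, ← h2]
  ring

theorem eq_at_of_eventuallyEq_punctured {f g : ℂ → ℂ} {p : ℂ} (hf : ContinuousAt f p)
    (hg : ContinuousAt g p) (h : ∀ᶠ z in nhdsWithin p {p}ᶜ, f z = g z) : f p = g p :=
  tendsto_nhds_unique_of_eventuallyEq (hf.tendsto.mono_left nhdsWithin_le_nhds)
    (hg.tendsto.mono_left nhdsWithin_le_nhds) h

/-- Freeze the parameter at s with |z| < s < 1: the expression is then analytic in the disc of
radius s, and on its boundary circle s = |z|, where the hypothesis applies. The maximum principle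
gives the bound inside, and closedness in s adds the endpoints s = |z| and s = 1. -/
theorem norm_quadratic_le_one {A B C : ℂ → ℂ} (hA : AnalyticOnNhd ℂ A (Metric.ball 0 1))
    (hB : AnalyticOnNhd ℂ B (Metric.ball 0 1)) (hC : AnalyticOnNhd ℂ C (Metric.ball 0 1))
    (h : ∀ z, ‖z‖ < 1 → z ≠ 0 →
      ‖A z + ((‖z‖ : ℂ) ^ 2 - 1) * B z + ((‖z‖ : ℂ) ^ 2 - 1) ^ 2 * C z‖ ≤ 1)
    {t : ℝ} (ht : t ≤ 1) {z : ℂ} (hz : ‖z‖ < 1) (hzt : ‖z‖ ≤ t) :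
    ‖A z + ((t : ℂ) ^ 2 - 1) * B z + ((t : ℂ) ^ 2 - 1) ^ 2 * C z‖ ≤ 1 := by
  have hcl : IsClosed {s : ℝ | ‖A z + ((s : ℂ) ^ 2 - 1) * B z + ((s : ℂ) ^ 2 - 1) ^ 2 * C z‖ ≤ 1} :=
    isClosed_le (by fun_prop) continuous_const
  have hsub : Set.Ioo ‖z‖ 1 ⊆
      {s : ℝ | ‖A z + ((s : ℂ) ^ 2 - 1) * B z + ((s : ℂ) ^ 2 - 1) ^ 2 * C z‖ ≤ 1} := by
    intro s hs
    have hs0 : 0 < s := (norm_nonneg z).trans_lt hs.1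
    have hd : DiffContOnCl ℂ
        (fun z => A z + ((s : ℂ) ^ 2 - 1) * B z + ((s : ℂ) ^ 2 - 1) ^ 2 * C z)
        (Metric.ball 0 s) := by
      apply DifferentiableOn.diffContOnCl
      rw [closure_ball _ hs0.ne']
      have hss : Metric.closedBall (0 : ℂ) s ⊆ Metric.ball 0 1 :=
        Metric.closedBall_subset_ball hs.2
      exact (((hA.differentiableOn.mono hss)).add
        ((hB.differentiableOn.mono hss).const_mul _)).add ((hC.differentiableOn.mono hss).const_mul _)
    refine Complex.norm_le_of_forall_mem_frontier_norm_le Metric.isBounded_ball hd (C := 1) ?_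
      (subset_closure (by simpa using hs.1))
    intro w hw
    rw [frontier_ball _ hs0.ne'] at hw
    have hw' : ‖w‖ = s := by simpa using hw
    have := h w (by rw [hw']; exact hs.2) (by intro h0; rw [h0, norm_zero] at hw'; linarith)
    rwa [hw'] at this
  have := closure_minimal hsub hcl
  rw [closure_Ioo hz.ne] at this
  exact this ⟨hzt, ht⟩

/-- Univalence of the quotient `v₁ / v₂` of two functions with Wronskian `γ`, in the disc. -/
theorem parallel_imp_eq_of_wronskian {ρ : ℝ} (hρ0 : 0 < ρ) (hρ : ρ ≤ 1) {v₁ v₂ k γ Y : ℂ → ℂ}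
    (hv₁ : AnalyticOnNhd ℂ v₁ (Metric.ball 0 ρ)) (hv₂ : AnalyticOnNhd ℂ v₂ (Metric.ball 0 ρ))
    (hk : AnalyticOnNhd ℂ k (Metric.ball 0 1)) (hγ : AnalyticOnNhd ℂ γ (Metric.ball 0 1))
    (hY : AnalyticOnNhd ℂ Y (Metric.ball 0 1))
    (hk0 : k 0 = 1) (hk1 : deriv k 0 = 0) (hγ1 : deriv γ 0 = 0)
    (hkne : ∀ z, ‖z‖ < 1 → k z ≠ 0) (hγne : ∀ z, ‖z‖ < 1 → γ z ≠ 0)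
    (hW : ∀ z, ‖z‖ < ρ → γ z = v₁ z * deriv v₂ z - deriv v₁ z * v₂ z)
    (hYQ : ∀ z, ‖z‖ < ρ → Y z * γ z = z ^ 2 * (deriv v₁ z * deriv (deriv v₂) z -
      deriv (deriv v₁) z * deriv v₂ z) - z * deriv γ z)
    (hbound : ∀ z, ‖z‖ < 1 → z ≠ 0 → ‖(1 - k z) / k z -
      ((‖z‖ : ℂ) ^ 2 - 1) * (z * deriv k z / k z + z * deriv γ z / γ z) +
      ((‖z‖ : ℂ) ^ 2 - 1) ^ 2 * (k z * Y z)‖ ≤ ‖z‖ ^ 2)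
    {x y : ℂ} (hx : ‖x‖ < ρ) (hy : ‖y‖ < ρ) (hxy : v₁ x * v₂ y = v₁ y * v₂ x) : x = y := by
  -- A constant matrix of determinant 1 applied to (v₁, v₂) preserves the Wronskian of the pair,
  -- that of its derivatives, and the parallel relation. Since γ(0) ≠ 0, such a matrix achieves the
  -- normalization.
  wlog hnorm : v₁ 0 = 1 ∧ deriv v₁ 0 = 0 ∧ v₂ 0 = 0 generalizing v₁ v₂
  · have h00 : ‖(0 : ℂ)‖ < ρ := by simpa using hρ0
    have hg0 : γ 0 ≠ 0 := hγne 0 (by simp)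
    have hW0 := hW 0 h00
    set a := deriv v₂ 0 / γ 0 with ha
    set b := -deriv v₁ 0 / γ 0 with hb
    set d := v₁ 0 with hd
    set e := -v₂ 0 with he
    have hdet : a * d - b * e = 1 := by
      rw [ha, hb, he]; field_simp; linear_combination -hW0
    have hu₁ : AnalyticOnNhd ℂ (fun z => a * v₁ z + b * v₂ z) (Metric.ball 0 ρ) :=
      (analyticOnNhd_const.mul hv₁).add (analyticOnNhd_const.mul hv₂)
    have hu₂ : AnalyticOnNhd ℂ (fun z => e * v₁ z + d * v₂ z) (Metric.ball 0 ρ) :=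
      (analyticOnNhd_const.mul hv₁).add (analyticOnNhd_const.mul hv₂)
    have D : ∀ (p q : ℂ) (f g : ℂ → ℂ), AnalyticOnNhd ℂ f (Metric.ball 0 ρ) →
        AnalyticOnNhd ℂ g (Metric.ball 0 ρ) → ∀ z, ‖z‖ < ρ →
        deriv (fun z => p * f z + q * g z) z = p * deriv f z + q * deriv g z := by
      intro p q f g hf hg z hz
      have hz' : z ∈ Metric.ball (0 : ℂ) ρ := by simpa using hz
      exact (((hf z hz').differentiableAt.hasDerivAt.const_mul p).add
        ((hg z hz').differentiableAt.hasDerivAt.const_mul q)).deriv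
    have D2 : ∀ (p q : ℂ), ∀ z, ‖z‖ < ρ → deriv (deriv (fun z => p * v₁ z + q * v₂ z)) z =
        p * deriv (deriv v₁) z + q * deriv (deriv v₂) z := by
      intro p q z hz
      have hz' : z ∈ Metric.ball (0 : ℂ) ρ := by simpa using hz
      have : deriv (fun z => p * v₁ z + q * v₂ z) =ᶠ[nhds z]
          fun z => p * deriv v₁ z + q * deriv v₂ z := by
        filter_upwards [Metric.isOpen_ball.mem_nhds hz'] with w hw
        exact D p q _ _ hv₁ hv₂ w (by simpa using hw)
      rw [this.deriv_eq]
      exact D p q _ _ hv₁.deriv hv₂.deriv z hz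
    refine this hu₁ hu₂ ?_ ?_ ?_ ?_
    · intro z hz
      rw [D _ _ _ _ hv₁ hv₂ z hz, D _ _ _ _ hv₁ hv₂ z hz, hW z hz]
      linear_combination -(v₁ z * deriv v₂ z - deriv v₁ z * v₂ z) * hdet
    · intro z hz
      rw [D _ _ _ _ hv₁ hv₂ z hz, D _ _ _ _ hv₁ hv₂ z hz, D2 _ _ z hz, D2 _ _ z hz, hYQ z hz]
      linear_combination -z ^ 2 * (deriv v₁ z * deriv (deriv v₂) z -
        deriv (deriv v₁) z * deriv v₂ z) * hdet
    · linear_combination (a * d - b * e) * hxy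
    · refine ⟨?_, ?_, ?_⟩
      · linear_combination hdet
      · rw [D _ _ _ _ hv₁ hv₂ 0 h00, ha, hb]; ring
      · rw [he, hd]; ring
  obtain ⟨n1, n2, n3⟩ := hnorm
  have hmem : ∀ {z : ℂ}, ‖z‖ < ρ → z ∈ Metric.ball (0 : ℂ) ρ := fun hz => by simpa using hz
  have hmem1 : ∀ {z : ℂ}, ‖z‖ < 1 → z ∈ Metric.ball (0 : ℂ) 1 := fun hz => by simpa using hz
  have hρ' : ∀ {z : ℂ}, ‖z‖ < ρ → ‖z‖ < 1 := fun hz => hz.trans_le hρ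
  have h00 : ‖(0 : ℂ)‖ < ρ := by simpa using hρ0
  set g₀ := γ 0 with hg₀
  have hg₀ne : g₀ ≠ 0 := hγne 0 (by simp)
  have d2 : deriv v₂ 0 = g₀ := by rw [hg₀, hW 0 h00, n1, n2]; ring
  have dd : ∀ {f : ℂ → ℂ} {s : Set ℂ}, AnalyticOnNhd ℂ f s → ∀ {z}, z ∈ s →
    HasDerivAt f (deriv f z) z := fun hf _ hz => (hf _ hz).differentiableAt.hasDerivAt
  have hγ' : ∀ z, ‖z‖ < ρ →
      deriv γ z = v₁ z * deriv (deriv v₂) z - deriv (deriv v₁) z * v₂ z := by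
    intro z hz
    have e : γ =ᶠ[nhds z] fun z => v₁ z * deriv v₂ z - deriv v₁ z * v₂ z := by
      filter_upwards [Metric.isOpen_ball.mem_nhds (hmem hz)] with w hw
      exact hW w (by simpa using hw)
    rw [e.deriv_eq]
    refine ((((dd hv₁ (hmem hz)).mul (dd hv₂.deriv (hmem hz))).sub
      ((dd hv₁.deriv (hmem hz)).mul (dd hv₂ (hmem hz)))).congr_deriv ?_).deriv
    ring
  -- The condition γ'(0) = 0 removes the quadratic term of v₂, which allows the form g₀z + z³w.
  have d22 : deriv (deriv v₂) 0 = 0 := by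
    have := hγ' 0 h00
    rw [hγ1, n1, n3] at this
    linear_combination -this
  -- the normal forms of the data
  obtain ⟨κ, hκ, hkκ⟩ := exists_eq_sq_mul Metric.isOpen_ball (hmem1 (by simp))
    (f := fun z => k z - 1) (hk.sub analyticOnNhd_const) (by simp [hk0]) (by simpa using hk1)
  obtain ⟨c, hc, hvc⟩ := exists_eq_sq_mul Metric.isOpen_ball (hmem h00)
    (f := fun z => v₁ z - 1) (hv₁.sub analyticOnNhd_const) (by simp [n1]) (by simpa using n2)
  obtain ⟨w, hw, hvw⟩ : ∃ w : ℂ → ℂ, AnalyticOnNhd ℂ w (Metric.ball 0 ρ) ∧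
      ∀ z, v₂ z = g₀ * z + z ^ 3 * w z := by
    have hn := Metric.isOpen_ball.mem_nhds (hmem h00)
    have hds : AnalyticOnNhd ℂ (dslope v₂ 0) (Metric.ball 0 ρ) :=
      DifferentiableOn.analyticOnNhd ((Complex.differentiableOn_dslope hn).mpr
        hv₂.differentiableOn) Metric.isOpen_ball
    have hv : v₂ = fun z => z * dslope v₂ 0 z := by
      funext z
      simpa [n3] using (sub_smul_dslope v₂ 0 z).symm
    have hdd : deriv (dslope v₂ 0) 0 = 0 := by
      have e : deriv v₂ =ᶠ[nhds 0] fun z => dslope v₂ 0 z + z * deriv (dslope v₂ 0) z := by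
        filter_upwards [hn] with z hz
        conv_lhs => rw [hv]
        refine (((hasDerivAt_id' z).mul (dd hds hz)).congr_deriv ?_).deriv
        ring
      have h2 := e.deriv_eq
      rw [d22, ((dd hds (hmem h00)).fun_add ((hasDerivAt_id' 0).fun_mul
        (dd hds.deriv (hmem h00)))).deriv] at h2
      simp at h2
      linear_combination (-1 / 2 : ℂ) * h2
    obtain ⟨w, hw, h⟩ := exists_eq_sq_mul Metric.isOpen_ball (hmem h00)
      (f := fun z => dslope v₂ 0 z - g₀) (hds.sub analyticOnNhd_const) (by simp [d2])
      (by simpa using hdd)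
    refine ⟨w, hw, fun z => ?_⟩
    have h1 : v₂ z = z * dslope v₂ 0 z := congrFun hv z
    rw [h1]
    linear_combination z * h z
  have hkκ' : ∀ z, k z = 1 + z ^ 2 * κ z := fun z => by linear_combination hkκ z
  have hvc' : ∀ z, v₁ z = 1 + z ^ 2 * c z := fun z => by linear_combination hvc z
  have hsq : ∀ {f : ℂ → ℂ} {s : Set ℂ}, AnalyticOnNhd ℂ f s → ∀ {z : ℂ}, z ∈ s →
      HasDerivAt (fun z => 1 + z ^ 2 * f z) (2 * z * f z + z ^ 2 * deriv f z) z := by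
    intro f s hf z hz
    refine (((hasDerivAt_pow 2 z).mul (dd hf hz)).const_add 1).congr_deriv ?_
    push_cast; ring
  have dk : ∀ z, ‖z‖ < 1 → deriv k z = 2 * z * κ z + z ^ 2 * deriv κ z := by
    intro z hz
    rw [funext hkκ']
    exact (hsq hκ (hmem1 hz)).deriv
  have dv₁ : ∀ z, ‖z‖ < ρ → deriv v₁ z = 2 * z * c z + z ^ 2 * deriv c z := by
    intro z hz
    rw [funext hvc']
    exact (hsq hc (hmem hz)).deriv
  have ddv₁ : ∀ z, ‖z‖ < ρ → deriv (deriv v₁) z =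
      2 * c z + 4 * z * deriv c z + z ^ 2 * deriv (deriv c) z := by
    intro z hz
    have e : deriv v₁ =ᶠ[nhds z] fun z => 2 * z * c z + z ^ 2 * deriv c z := by
      filter_upwards [Metric.isOpen_ball.mem_nhds (hmem hz)] with w hw
      exact dv₁ w (by simpa using hw)
    rw [e.deriv_eq]
    refine (((((hasDerivAt_id' z).const_mul 2).mul (dd hc (hmem hz))).add
      ((hasDerivAt_pow 2 z).mul (dd hc.deriv (hmem hz)))).congr_deriv ?_).deriv
    push_cast; ring
  have dv₂ : ∀ z, ‖z‖ < ρ → deriv v₂ z = g₀ + 3 * z ^ 2 * w z + z ^ 3 * deriv w z := by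
    intro z hz
    rw [funext hvw]
    refine ((((hasDerivAt_id' z).const_mul g₀).add
      ((hasDerivAt_pow 3 z).mul (dd hw (hmem hz)))).congr_deriv ?_).deriv
    push_cast; ring
  have ddv₂ : ∀ z, ‖z‖ < ρ → deriv (deriv v₂) z =
      6 * z * w z + 6 * z ^ 2 * deriv w z + z ^ 3 * deriv (deriv w) z := by
    intro z hz
    have e : deriv v₂ =ᶠ[nhds z] fun z => g₀ + 3 * z ^ 2 * w z + z ^ 3 * deriv w z := by
      filter_upwards [Metric.isOpen_ball.mem_nhds (hmem hz)] with w hw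
      exact dv₂ w (by simpa using hw)
    rw [e.deriv_eq]
    refine ((((((hasDerivAt_pow 2 z).const_mul 3).mul (dd hw (hmem hz))).const_add g₀).add
      ((hasDerivAt_pow 3 z).mul (dd hw.deriv (hmem hz)))).congr_deriv ?_).deriv
    push_cast; ring
  let Γ : ℂ → ℂ := fun z =>
    (1 + z ^ 2 * c z) * (g₀ + 3 * z ^ 2 * w z + z ^ 3 * deriv w z) -
      (2 * z * c z + z ^ 2 * deriv c z) * (g₀ * z + z ^ 3 * w z)
  let G : ℂ → ℂ := fun z =>
    (1 + z ^ 2 * c z) * (6 * w z + 6 * z * deriv w z + z ^ 2 * deriv (deriv w) z) -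
      (2 * c z + 4 * z * deriv c z + z ^ 2 * deriv (deriv c) z) * (g₀ + z ^ 2 * w z)
  let Q : ℂ → ℂ := fun z => (2 * z * c z + z ^ 2 * deriv c z) *
      (6 * z * w z + 6 * z ^ 2 * deriv w z + z ^ 3 * deriv (deriv w) z) -
    (2 * c z + 4 * z * deriv c z + z ^ 2 * deriv (deriv c) z) *
      (g₀ + 3 * z ^ 2 * w z + z ^ 3 * deriv w z)
  have hΓ : ∀ z, ‖z‖ < ρ → γ z = Γ z := by
    intro z hz
    rw [hW z hz, dv₁ z hz, dv₂ z hz, hvc', hvw]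
  have hγG : ∀ z, ‖z‖ < ρ → deriv γ z = z * G z := by
    intro z hz
    rw [hγ' z hz, ddv₁ z hz, ddv₂ z hz, hvc', hvw]
    simp only [G]; ring
  have hYG : ∀ z, ‖z‖ < ρ → Y z * γ z = z ^ 2 * (Q z - G z) := by
    intro z hz
    rw [hYQ z hz, dv₁ z hz, dv₂ z hz, ddv₁ z hz, ddv₂ z hz, hγG z hz]
    simp only [Q]; ring
  have hGa : AnalyticOnNhd ℂ G (Metric.ball 0 ρ) := by
    intro z hz
    have := hc z hz
    have := hw z hz
    have := hc.deriv z hz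
    have := hw.deriv z hz
    have := hc.deriv.deriv z hz
    have := hw.deriv.deriv z hz
    fun_prop
  have hQa : AnalyticOnNhd ℂ Q (Metric.ball 0 ρ) := by
    intro z hz
    have := hc z hz
    have := hw z hz
    have := hc.deriv z hz
    have := hw.deriv z hz
    have := hc.deriv.deriv z hz
    have := hw.deriv.deriv z hz
    fun_prop
  have hpunct : ∀ᶠ z in nhdsWithin (0 : ℂ) {0}ᶜ, ‖z‖ < ρ ∧ z ≠ 0 := by
    have h1 : ∀ᶠ z in nhdsWithin (0 : ℂ) {0}ᶜ, z ∈ Metric.ball (0 : ℂ) ρ :=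
      mem_nhdsWithin_of_mem_nhds (Metric.isOpen_ball.mem_nhds (hmem h00))
    filter_upwards [h1, self_mem_nhdsWithin] with z hz hz'
    exact ⟨by simpa using hz, hz'⟩
  -- `γ'` is divisible by `z` and `Y` by `z²` in the whole disc
  have hG₂ : AnalyticOnNhd ℂ (dslope (deriv γ) 0) (Metric.ball 0 1) :=
    DifferentiableOn.analyticOnNhd ((Complex.differentiableOn_dslope
      (Metric.isOpen_ball.mem_nhds (hmem1 (by simp)))).mpr hγ.deriv.differentiableOn)
      Metric.isOpen_ball
  set G₂ := dslope (deriv γ) 0 with hG₂def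
  have hγG₂ : ∀ z, deriv γ z = z * G₂ z := by
    intro z
    simpa [hγ1] using (sub_smul_dslope (deriv γ) 0 z).symm
  have hGG₂ : ∀ z, ‖z‖ < ρ → G₂ z = G z := by
    have h : ∀ z, ‖z‖ < ρ → z ≠ 0 → G₂ z = G z := by
      intro z hz hz0
      have := hγG z hz
      rw [hγG₂ z] at this
      exact mul_left_cancel₀ hz0 this
    intro z hz
    by_cases hz0 : z = 0
    · subst hz0
      exact eq_at_of_eventuallyEq_punctured (hG₂ 0 (hmem1 (by simp))).continuousAt
        (hGa 0 (hmem h00)).continuousAt (hpunct.mono fun z hz => h z hz.1 hz.2)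
    · exact h z hz hz0
  have hYR : ∀ z, ‖z‖ < ρ → Y z = z ^ 2 * ((Q z - G z) / γ z) := by
    intro z hz
    have := hYG z hz
    have h2 := hγne z (hρ' hz)
    field_simp
    linear_combination this
  have hRa : AnalyticAt ℂ (fun z => (Q z - G z) / γ z) 0 :=
    ((hQa 0 (hmem h00)).sub (hGa 0 (hmem h00))).div (hγ 0 (hmem1 (by simp))) hg₀ne
  obtain ⟨Y₂, hY₂, hYY₂⟩ := exists_eq_sq_mul Metric.isOpen_ball (hmem1 (by simp)) hY
    (by rw [hYR 0 h00]; ring) (by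
      have e : Y =ᶠ[nhds 0] fun z => z ^ 2 * ((Q z - G z) / γ z) := by
        filter_upwards [Metric.isOpen_ball.mem_nhds (hmem h00)] with z hz
        exact hYR z (by simpa using hz)
      rw [e.deriv_eq, ((hasDerivAt_pow 2 0).fun_mul hRa.differentiableAt.hasDerivAt).deriv]
      simp)
  have hYQ₂ : ∀ z, ‖z‖ < ρ → Y₂ z * γ z = Q z - G z := by
    have h : ∀ z, ‖z‖ < ρ → z ≠ 0 → Y₂ z * γ z = Q z - G z := by
      intro z hz hz0
      have := hYG z hz
      rw [hYY₂ z] at this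
      exact mul_left_cancel₀ (pow_ne_zero 2 hz0) (by linear_combination this)
    intro z hz
    by_cases hz0 : z = 0
    · subst hz0
      exact eq_at_of_eventuallyEq_punctured
        ((hY₂ 0 (hmem1 (by simp))).mul (hγ 0 (hmem1 (by simp)))).continuousAt
        ((hQa 0 (hmem h00)).sub (hGa 0 (hmem h00))).continuousAt
        (hpunct.mono fun z hz => h z hz.1 hz.2)
    · exact h z hz hz0
  -- The coefficients of Ψ. All three terms of the bound are divisible by z², so a bound by |z|²
  -- turns into a bound by 1.
  let A : ℂ → ℂ := fun z => -κ z / k z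
  let B : ℂ → ℂ := fun z => -((2 * κ z + z * deriv κ z) / k z + G₂ z / γ z)
  let C : ℂ → ℂ := fun z => k z * Y₂ z
  have hA : AnalyticOnNhd ℂ A (Metric.ball 0 1) :=
    fun z hz => (hκ z hz).neg.div (hk z hz) (hkne z (by simpa using hz))
  have hB : AnalyticOnNhd ℂ B (Metric.ball 0 1) := by
    intro z hz
    have h1 := hκ z hz
    have h2 := hκ.deriv z hz
    exact ((((analyticAt_const.mul h1).add (analyticAt_id.mul h2)).div (hk z hz)
      (hkne z (by simpa using hz))).add ((hG₂ z hz).div (hγ z hz)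
      (hγne z (by simpa using hz)))).neg
  have hC : AnalyticOnNhd ℂ C (Metric.ball 0 1) := fun z hz => (hk z hz).mul (hY₂ z hz)
  have hABC : ∀ z, ‖z‖ < 1 → z ≠ 0 →
      ‖A z + ((‖z‖ : ℂ) ^ 2 - 1) * B z + ((‖z‖ : ℂ) ^ 2 - 1) ^ 2 * C z‖ ≤ 1 := by
    intro z hz hz0
    have h := hbound z hz hz0
    have e : (1 - k z) / k z -
      ((‖z‖ : ℂ) ^ 2 - 1) * (z * deriv k z / k z + z * deriv γ z / γ z) +
      ((‖z‖ : ℂ) ^ 2 - 1) ^ 2 * (k z * Y z) =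
        z ^ 2 * (A z + ((‖z‖ : ℂ) ^ 2 - 1) * B z + ((‖z‖ : ℂ) ^ 2 - 1) ^ 2 * C z) := by
      have h1 : (1 - k z) / k z = z ^ 2 * A z := by
        simp only [A]
        rw [show 1 - k z = z ^ 2 * -κ z by rw [hkκ']; ring]
        ring
      rw [h1, dk z hz, hγG₂ z, hYY₂ z]
      simp only [B, C]
      ring
    rw [e, norm_mul, norm_pow] at h
    exact le_of_mul_le_mul_left (by simpa using h) (by positivity)
  -- The entry ρ/2 only keeps the radius positive when x = y = 0.
  set r := max (max ‖x‖ ‖y‖) (ρ / 2) with hr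
  have hr0 : 0 < r := lt_max_of_lt_right (by linarith)
  have hrρ : r < ρ := max_lt (max_lt hx hy) (by linarith)
  refine parallel_imp_eq_of_bound (c := c) (κ := κ) (w := w) (k := k) (γ := Γ) (G := G) (Q := Q)
    (Ψ := fun t z => A z + ((t : ℂ) ^ 2 - 1) * B z + ((t : ℂ) ^ 2 - 1) ^ 2 * C z)
    hr0 hrρ hρ hg₀ne hc (hκ.mono (Metric.ball_subset_ball hρ)) hw hkκ' (fun _ => rfl)
    (fun _ => rfl) (fun _ => rfl) (fun z hz => hkne z (hρ' hz))
    (fun z hz => hΓ z hz ▸ hγne z (hρ' hz)) ?_ ?_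
    (x := x) (y := y) ((le_max_left _ _).trans (le_max_left _ _))
    ((le_max_right _ _).trans (le_max_left _ _)) ?_
  · intro t _ _ z hz
    have h1 := hkne z (hρ' hz)
    have h2 := hγne z (hρ' hz)
    rw [← hΓ z hz, ← hGG₂ z hz]
    have h3 : A z * (k z * γ z) = -κ z * γ z := by simp only [A]; field_simp
    have h4 : B z * (k z * γ z) = -((2 * κ z + z * deriv κ z) * γ z + k z * G₂ z) := by
      simp only [B]; field_simp
    have h5 : C z * (k z * γ z) = k z ^ 2 * (Q z - G₂ z) := by
      rw [hGG₂ z hz, ← hYQ₂ z hz]; simp only [C]; ring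
    linear_combination h3 + ((t : ℂ) ^ 2 - 1) * h4 + ((t : ℂ) ^ 2 - 1) ^ 2 * h5
  · intro t _ ht1 z hz hzt
    exact norm_quadratic_le_one hA hB hC hABC ht1 (hρ' hz) hzt
  · rw [← hvc', ← hvc', ← hvw, ← hvw, hxy]

/-! ### Local quotient representations and their Schwarzians -/

open Filter Topology

/-- Near `p`, the meromorphic function `F` is a quotient of two analytic functions with
nonvanishing Wronskian; in other words, `F` is locally univalent at `p` as a map into the sphere. -/
def LocalPair (F : ℂ → ℂ) (p : ℂ) : Prop :=
  ∃ a b : ℂ → ℂ, AnalyticAt ℂ a p ∧ AnalyticAt ℂ b p ∧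
    a p * deriv b p - deriv a p * b p ≠ 0 ∧ ∀ᶠ z in 𝓝[≠] p, b z ≠ 0 ∧ F z * b z = a z

/-- With W the Wronskian, F' = -W/b²; its logarithmic derivative is W'/W - 2b'/b, where W' = ab'' -
a''b. -/
theorem preSchwarzian_of_eventuallyEq_div {F a b : ℂ → ℂ} {z : ℂ} (ha : AnalyticAt ℂ a z)
    (hb : AnalyticAt ℂ b z) (hbz : b z ≠ 0)
    (hW : a z * deriv b z - deriv a z * b z ≠ 0) (hF : ∀ᶠ w in 𝓝 z, F w * b w = a w) :
    deriv F z = -(a z * deriv b z - deriv a z * b z) / b z ^ 2 ∧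
    preSchwarzian F z = (a z * deriv (deriv b) z - deriv (deriv a) z * b z) /
      (a z * deriv b z - deriv a z * b z) - 2 * deriv b z / b z := by
  have e1 : ∀ᶠ w in 𝓝 z, deriv F w = -(a w * deriv b w - deriv a w * b w) / b w ^ 2 := by
    filter_upwards [hF.eventually_nhds, (hb.continuousAt.eventually_ne hbz).eventually_nhds,
      ha.eventually_analyticAt, hb.eventually_analyticAt] with w h1 h2 h3 h4
    have e : F =ᶠ[𝓝 w] fun w => a w / b w := by
      filter_upwards [h1, h2] with x hx hx'
      rw [← hx]; field_simp
    rw [e.deriv_eq]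
    refine ((h3.differentiableAt.hasDerivAt.fun_div h4.differentiableAt.hasDerivAt
      h2.self_of_nhds).congr_deriv ?_).deriv
    ring
  refine ⟨e1.self_of_nhds, ?_⟩
  have hd : deriv (deriv F) z = deriv (fun w => -(a w * deriv b w - deriv a w * b w) / b w ^ 2) z :=
    EventuallyEq.deriv_eq e1
  have h1 := ha.differentiableAt.hasDerivAt
  have h2 := hb.differentiableAt.hasDerivAt
  have h3 := ha.deriv.differentiableAt.hasDerivAt
  have h4 := hb.deriv.differentiableAt.hasDerivAt
  rw [preSchwarzian, hd, e1.self_of_nhds,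
    ((((h1.fun_mul h4).fun_sub (h3.fun_mul h2)).fun_neg).fun_div (h2.fun_pow 2)
      (pow_ne_zero 2 hbz)).deriv]
  obtain ⟨W, hWe⟩ : ∃ W, W = a z * deriv b z - deriv a z * b z := ⟨_, rfl⟩
  rw [← hWe] at hW ⊢
  field_simp
  rw [hWe]
  ring

/-- All terms with b in the denominator cancel: S_F = (W'/W)' - ½(W'/W)² + 2(a'b'' - a''b')/W. Only
W is divided by, so the formula extends analytically across the poles of F. -/
theorem schwarzian_of_eventuallyEq_div {F a b : ℂ → ℂ} {z : ℂ} (ha : AnalyticAt ℂ a z)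
    (hb : AnalyticAt ℂ b z) (hbz : b z ≠ 0)
    (hW : a z * deriv b z - deriv a z * b z ≠ 0) (hF : ∀ᶠ w in 𝓝 z, F w * b w = a w) :
    schwarzian F z =
      deriv (fun w => (a w * deriv (deriv b) w - deriv (deriv a) w * b w) /
        (a w * deriv b w - deriv a w * b w)) z -
      (1 / 2 : ℂ) * ((a z * deriv (deriv b) z - deriv (deriv a) z * b z) /
        (a z * deriv b z - deriv a z * b z)) ^ 2 +
      2 * ((deriv a z * deriv (deriv b) z - deriv (deriv a) z * deriv b z) /
        (a z * deriv b z - deriv a z * b z)) := by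
  have hWa : AnalyticAt ℂ (fun w => a w * deriv b w - deriv a w * b w) z :=
    (ha.mul hb.deriv).sub (ha.deriv.mul hb)
  have hPa : AnalyticAt ℂ (fun w => (a w * deriv (deriv b) w - deriv (deriv a) w * b w) /
        (a w * deriv b w - deriv a w * b w)) z :=
    ((ha.mul hb.deriv.deriv).sub (ha.deriv.deriv.mul hb)).div hWa hW
  have e1 : preSchwarzian F =ᶠ[𝓝 z] fun w =>
      (a w * deriv (deriv b) w - deriv (deriv a) w * b w) /
        (a w * deriv b w - deriv a w * b w) - 2 * deriv b w / b w := by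
    filter_upwards [hF.eventually_nhds, hb.continuousAt.eventually_ne hbz,
      hWa.continuousAt.eventually_ne hW, ha.eventually_analyticAt, hb.eventually_analyticAt]
      with w h1 h2 h3 h4 h5
    exact (preSchwarzian_of_eventuallyEq_div h4 h5 h2 h3 h1).2
  have h2 := hb.differentiableAt.hasDerivAt
  have h4 := hb.deriv.differentiableAt.hasDerivAt
  rw [schwarzian, e1.deriv_eq, e1.self_of_nhds,
    (hPa.differentiableAt.hasDerivAt.fun_sub ((h4.const_mul 2).fun_div h2 hbz)).deriv]
  beta_reduce
  generalize deriv (fun w => (a w * deriv (deriv b) w - deriv (deriv a) w * b w) /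
    (a w * deriv b w - deriv a w * b w)) z = D
  obtain ⟨W, hWe⟩ : ∃ W, W = a z * deriv b z - deriv a z * b z := ⟨_, rfl⟩
  rw [← hWe] at hW ⊢
  field_simp
  rw [hWe]
  ring

theorem LocalPair.exists_analyticAt_schwarzian {F : ℂ → ℂ} {p : ℂ} (h : LocalPair F p) :
    ∃ T : ℂ → ℂ, AnalyticAt ℂ T p ∧ ∀ᶠ z in 𝓝[≠] p, schwarzian F z = T z := by
  obtain ⟨a, b, ha, hb, hW, hF⟩ := h
  have hWa : AnalyticAt ℂ (fun w => a w * deriv b w - deriv a w * b w) p :=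
    (ha.mul hb.deriv).sub (ha.deriv.mul hb)
  have hPa : AnalyticAt ℂ (fun w => (a w * deriv (deriv b) w - deriv (deriv a) w * b w) /
        (a w * deriv b w - deriv a w * b w)) p :=
    ((ha.mul hb.deriv.deriv).sub (ha.deriv.deriv.mul hb)).div hWa hW
  refine ⟨_, (hPa.deriv.sub ((analyticAt_const (v := (1 / 2 : ℂ))).mul (hPa.pow 2))).add
    ((analyticAt_const (v := (2 : ℂ))).mul (((ha.deriv.mul hb.deriv.deriv).sub (ha.deriv.deriv.mul hb.deriv)).div hWa hW)), ?_⟩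
  filter_upwards [eventually_eventually_nhdsWithin.mpr hF, hF, self_mem_nhdsWithin,
    (hWa.continuousAt.eventually_ne hW).filter_mono nhdsWithin_le_nhds,
    ha.eventually_analyticAt.filter_mono nhdsWithin_le_nhds,
    hb.eventually_analyticAt.filter_mono nhdsWithin_le_nhds] with z h1 h2 h3 h4 h5 h6
  rw [isOpen_compl_singleton.nhdsWithin_eq h3] at h1
  exact schwarzian_of_eventuallyEq_div h5 h6 h2.1 h4 (h1.mono fun w hw => hw.2)

/-- Two of the germs agree with ψ, hence with each other, off their centres. By continuity the value
of each germ at its own centre fits its neighbours, so these values form one analytic function. -/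
theorem exists_analyticOnNhd_of_locally {U : Set ℂ} (hU : IsOpen U) {ψ : ℂ → ℂ}
    (h : ∀ p ∈ U, ∃ T : ℂ → ℂ, AnalyticAt ℂ T p ∧ ∀ᶠ z in 𝓝[≠] p, ψ z = T z) :
    ∃ Y : ℂ → ℂ, AnalyticOnNhd ℂ Y U ∧ ∀ p ∈ U, ∀ᶠ z in 𝓝[≠] p, ψ z = Y z := by
  choose! T hT hψ using h
  have key : ∀ p ∈ U, ∀ᶠ z in 𝓝 p, T z z = T p z := by
    intro p hp
    have h1 : ∀ᶠ z in 𝓝[≠] p, T z z = T p z := by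
      filter_upwards [eventually_eventually_nhdsWithin.mpr (hψ p hp), self_mem_nhdsWithin,
        (hT p hp).eventually_analyticAt.filter_mono nhdsWithin_le_nhds,
        mem_nhdsWithin_of_mem_nhds (hU.mem_nhds hp)] with z h1 h2 h3 h4
      rw [isOpen_compl_singleton.nhdsWithin_eq h2] at h1
      refine eq_at_of_eventuallyEq_punctured (hT z h4).continuousAt h3.continuousAt ?_
      filter_upwards [hψ z h4, h1.filter_mono nhdsWithin_le_nhds] with w e1 e2
      rw [← e1, e2]
    rw [eventually_nhdsWithin_iff] at h1
    filter_upwards [h1] with z hz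
    by_cases hzp : z = p
    · rw [hzp]
    · exact hz hzp
  refine ⟨fun z => T z z, fun p hp => (hT p hp).congr ((key p hp).mono fun z hz => hz.symm), ?_⟩
  intro p hp
  filter_upwards [hψ p hp, (key p hp).filter_mono nhdsWithin_le_nhds] with z h1 h2
  rw [h1, h2]

/-- A primitive L of δ'/δ exists in the disc and δe^(-L) is constant; normalizing L at 0 makes δ =
e^L, with square root e^(L/2). -/
theorem exists_sq_eq {ρ : ℝ} (hρ : 0 < ρ) {δ : ℂ → ℂ} (hδ : AnalyticOnNhd ℂ δ (Metric.ball 0 ρ))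
    (hδ0 : ∀ z ∈ Metric.ball (0 : ℂ) ρ, δ z ≠ 0) :
    ∃ χ : ℂ → ℂ, AnalyticOnNhd ℂ χ (Metric.ball 0 ρ) ∧ ∀ z ∈ Metric.ball (0 : ℂ) ρ,
      χ z ^ 2 = δ z := by
  have hl : AnalyticOnNhd ℂ (fun z => deriv δ z / δ z) (Metric.ball 0 ρ) :=
    fun z hz => (hδ.deriv z hz).div (hδ z hz) (hδ0 z hz)
  obtain ⟨L, hL0, hL⟩ := hl.differentiableOn.isExactOn_ball.with_val_at 0 (Complex.log (δ 0))
  have hLd : DifferentiableOn ℂ L (Metric.ball 0 ρ) :=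
    fun z hz => (hL z hz).differentiableAt.differentiableWithinAt
  have h0 : (0 : ℂ) ∈ Metric.ball (0 : ℂ) ρ := by simpa using hρ
  have hconst : ∀ z ∈ Metric.ball (0 : ℂ) ρ, δ z * Complex.exp (-L z) = 1 := by
    intro z hz
    have hd : ∀ z ∈ Metric.ball (0 : ℂ) ρ,
        HasDerivAt (fun z => δ z * Complex.exp (-L z)) 0 z := by
      intro z hz
      refine ((hδ z hz).differentiableAt.hasDerivAt.fun_mul
        ((hL z hz).fun_neg.cexp)).congr_deriv ?_
      have := hδ0 z hz
      field_simp
      ring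
    have := Metric.isOpen_ball.is_const_of_deriv_eq_zero
      (convex_ball (0 : ℂ) ρ).isPreconnected
      (fun z hz => (hd z hz).differentiableAt.differentiableWithinAt)
      (fun z hz => (hd z hz).deriv) hz h0
    rw [this, hL0, Complex.exp_neg, Complex.exp_log (hδ0 0 h0)]
    exact mul_inv_cancel₀ (hδ0 0 h0)
  refine ⟨fun z => Complex.exp (L z / 2), DifferentiableOn.analyticOnNhd
    ((hLd.div_const 2).cexp) Metric.isOpen_ball, fun z hz => ?_⟩
  have := hconst z hz
  rw [Complex.exp_neg, mul_inv_eq_one₀ (Complex.exp_ne_zero _)] at this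
  rw [this, ← Complex.exp_nat_mul]
  congr 1
  push_cast; ring

/-- A nonzero Wronskian makes every zero of b simple, so the product and b vanish at p to the same
order, 0 or 1, and their ratio is a unit. -/
theorem exists_factor_of_simple_zeros {S : Finset ℂ} {a b : ℂ → ℂ} {p : ℂ}
    (hb : AnalyticAt ℂ b p) (hW : a p * deriv b p - deriv a p * b p ≠ 0)
    (hS : p ∈ S ↔ b p = 0) :
    ∃ u : ℂ → ℂ, AnalyticAt ℂ u p ∧ u p ≠ 0 ∧ ∀ᶠ z in 𝓝 p, ∏ q ∈ S, (z - q) = u z * b z := by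
  have hprod : ∀ T : Finset ℂ, AnalyticAt ℂ (fun z => ∏ q ∈ T, (z - q)) p :=
    fun T => Finset.analyticAt_fun_prod T fun q _ => analyticAt_id.sub analyticAt_const
  have hprod0 : ∀ T : Finset ℂ, p ∉ T → ∏ q ∈ T, (p - q) ≠ 0 := fun T hT =>
    Finset.prod_ne_zero_iff.mpr fun q hq h => hT (sub_eq_zero.mp h ▸ hq)
  by_cases hbp : b p = 0
  · have hpS := hS.mpr hbp
    have hβ : AnalyticAt ℂ (dslope b p) p := by
      obtain ⟨U, hU, hUo, hpU⟩ := eventually_nhds_iff.mp hb.eventually_analyticAt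
      exact DifferentiableOn.analyticAt ((Complex.differentiableOn_dslope (hUo.mem_nhds hpU)).mpr
        fun z hz => (hU z hz).differentiableAt.differentiableWithinAt) (hUo.mem_nhds hpU)
    have hβ0 : dslope b p p ≠ 0 := by
      rw [dslope_same]
      intro h
      rw [h, hbp] at hW
      simp at hW
    refine ⟨fun z => (∏ q ∈ S.erase p, (z - q)) / dslope b p z, (hprod _).div hβ hβ0,
      div_ne_zero (hprod0 _ (Finset.notMem_erase p S)) hβ0, ?_⟩
    filter_upwards [hβ.continuousAt.eventually_ne hβ0] with z hz
    have hbz : b z = (z - p) * dslope b p z := by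
      simpa [hbp] using (sub_smul_dslope b p z).symm
    rw [← Finset.mul_prod_erase S _ hpS, hbz]
    field_simp
  · have hpS : p ∉ S := fun h => hbp (hS.mp h)
    refine ⟨fun z => (∏ q ∈ S, (z - q)) / b z, (hprod S).div hb hbp,
      div_ne_zero (hprod0 S hpS) hbp, ?_⟩
    filter_upwards [hb.continuousAt.eventually_ne hbp] with z hz
    field_simp

/-- In a disc, local representations as a quotient can be replaced by a single one. -/
theorem exists_global_pair {ρ : ℝ} {F : ℂ → ℂ}
    (hF : ∀ p ∈ Metric.closedBall (0 : ℂ) ρ, LocalPair F p) :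
    ∃ a b : ℂ → ℂ, AnalyticOnNhd ℂ a (Metric.ball 0 ρ) ∧ AnalyticOnNhd ℂ b (Metric.ball 0 ρ) ∧
      (∀ z ∈ Metric.ball (0 : ℂ) ρ, a z * deriv b z - deriv a z * b z ≠ 0) ∧
      ∀ p ∈ Metric.ball (0 : ℂ) ρ, ∀ᶠ z in 𝓝[≠] p, b z ≠ 0 ∧ F z * b z = a z := by
  let K := Metric.closedBall (0 : ℂ) ρ
  -- The poles of F, described without reference to a local pair; each pair has its denominator
  -- vanishing exactly there.
  let P : Set ℂ := {p | p ∈ K ∧ Tendsto (fun z => ‖F z‖) (𝓝[≠] p) atTop}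
  have nottend : ∀ {a b : ℂ → ℂ} {p : ℂ}, ContinuousAt a p → ContinuousAt b p → b p ≠ 0 →
      (∀ᶠ z in 𝓝[≠] p, F z * b z = a z) → ¬ Tendsto (fun z => ‖F z‖) (𝓝[≠] p) atTop := by
    intro a b p ha hb hbp h ht
    have h1 : Tendsto (fun z => ‖a z / b z‖) (𝓝[≠] p) (𝓝 ‖a p / b p‖) :=
      ((ha.div hb hbp).norm.tendsto).mono_left nhdsWithin_le_nhds
    refine not_tendsto_nhds_of_tendsto_atTop ht ‖a p / b p‖ (h1.congr' ?_)
    filter_upwards [h, (hb.eventually_ne hbp).filter_mono nhdsWithin_le_nhds] with z hz hz'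
    rw [← hz, mul_div_cancel_right₀ _ hz']
  have hPiff : ∀ {a b : ℂ → ℂ} {p : ℂ}, p ∈ K → AnalyticAt ℂ a p → AnalyticAt ℂ b p →
      a p * deriv b p - deriv a p * b p ≠ 0 → (∀ᶠ z in 𝓝[≠] p, b z ≠ 0 ∧ F z * b z = a z) →
      (p ∈ P ↔ b p = 0) := by
    intro a b p hp ha hb hW h
    constructor
    · intro hpP
      by_contra hbp
      exact nottend ha.continuousAt hb.continuousAt hbp (h.mono fun z hz => hz.2) hpP.2
    · intro hbp
      have hap : a p ≠ 0 := by intro h'; rw [h', hbp] at hW; simp at hW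
      refine ⟨hp, ?_⟩
      have h1 : Tendsto (fun z => ‖b z‖⁻¹) (𝓝[≠] p) atTop := by
        refine tendsto_inv_nhdsGT_zero.comp (tendsto_nhdsWithin_iff.mpr ⟨?_, ?_⟩)
        · have := hb.continuousAt.norm.tendsto
          rw [hbp, norm_zero] at this
          exact this.mono_left nhdsWithin_le_nhds
        · exact h.mono fun z hz => norm_pos_iff.mpr hz.1
      have h2 : Tendsto (fun z => ‖a z‖) (𝓝[≠] p) (𝓝 ‖a p‖) :=
        ha.continuousAt.norm.tendsto.mono_left nhdsWithin_le_nhds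
      refine (h2.pos_mul_atTop (norm_pos_iff.mpr hap) h1).congr' ?_
      filter_upwards [h] with z hz
      rw [← hz.2, norm_mul, mul_assoc, mul_inv_cancel₀ (norm_ne_zero_iff.mpr hz.1), mul_one]
  -- An accumulation point of poles in the compact disc would itself have a local pair, whose
  -- denominator is nonzero in a punctured neighbourhood.
  have hPfin : P.Finite := by
    by_contra hinf
    obtain ⟨p, hp, hacc⟩ := Set.Infinite.exists_accPt_of_subset_isCompact hinf
      (isCompact_closedBall (0 : ℂ) ρ) (fun p hp => hp.1)
    obtain ⟨a, b, ha, hb, hW, h⟩ := hF p hp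
    rw [accPt_iff_frequently_nhdsNE] at hacc
    refine hacc ?_
    filter_upwards [h, eventually_eventually_nhdsWithin.mpr h, self_mem_nhdsWithin,
      ha.eventually_analyticAt.filter_mono nhdsWithin_le_nhds,
      hb.eventually_analyticAt.filter_mono nhdsWithin_le_nhds] with z h1 h2 h3 h4 h5 hz
    rw [isOpen_compl_singleton.nhdsWithin_eq h3] at h2
    exact nottend h4.continuousAt h5.continuousAt h1.1
      ((h2.filter_mono nhdsWithin_le_nhds).mono fun w hw => hw.2) hz.2
  let S := hPfin.toFinset
  let B : ℂ → ℂ := fun z => ∏ q ∈ S, (z - q)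
  have hBa : ∀ p, AnalyticAt ℂ B p :=
    fun p => Finset.analyticAt_fun_prod S fun q _ => analyticAt_id.sub analyticAt_const
  have hloc : ∀ p ∈ Metric.ball (0 : ℂ) ρ, ∃ a b u : ℂ → ℂ, AnalyticAt ℂ a p ∧ AnalyticAt ℂ b p ∧
      AnalyticAt ℂ u p ∧ u p ≠ 0 ∧ a p * deriv b p - deriv a p * b p ≠ 0 ∧
      (∀ᶠ z in 𝓝 p, B z = u z * b z) ∧ ∀ᶠ z in 𝓝[≠] p, b z ≠ 0 ∧ F z * b z = a z := by
    intro p hp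
    have hpK := Metric.ball_subset_closedBall hp
    obtain ⟨a, b, ha, hb, hW, h⟩ := hF p hpK
    obtain ⟨u, hu, hu0, hB⟩ := exists_factor_of_simple_zeros (S := S) hb hW (by
      rw [← hPiff hpK ha hb hW h]; simp [S])
    exact ⟨a, b, u, ha, hb, hu, hu0, hW, hB, h⟩
  obtain ⟨A, hA, hFA⟩ := exists_analyticOnNhd_of_locally Metric.isOpen_ball
    (ψ := fun z => F z * B z) (U := Metric.ball 0 ρ) (by
      intro p hp
      obtain ⟨a, b, u, ha, hb, hu, hu0, hW, hB, h⟩ := hloc p hp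
      refine ⟨fun z => u z * a z, hu.mul ha, ?_⟩
      filter_upwards [h, hB.filter_mono nhdsWithin_le_nhds] with z h1 h2
      rw [h2, ← h1.2]; ring)
  refine ⟨A, B, hA, fun p _ => hBa p, ?_, ?_⟩
  · intro p hp
    obtain ⟨a, b, u, ha, hb, hu, hu0, hW, hB, h⟩ := hloc p hp
    -- The global pair is locally u times a local pair, with u a unit, so the Wronskian is
    -- multiplied by u².
    have hAe : ∀ᶠ z in 𝓝 p, A z = u z * a z := by
      refine ((hA p hp).frequently_eq_iff_eventually_eq (hu.mul ha)).mp (Eventually.frequently ?_)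
      filter_upwards [hFA p hp, h, hB.filter_mono nhdsWithin_le_nhds] with z h1 h2 h3
      rw [← h1, h3, Pi.mul_apply, ← h2.2]; ring
    have hu' := hu.differentiableAt.hasDerivAt
    have dA : deriv A p = deriv u p * a p + u p * deriv a p := by
      rw [EventuallyEq.deriv_eq hAe]
      exact (hu'.fun_mul ha.differentiableAt.hasDerivAt).deriv
    have dB : deriv B p = deriv u p * b p + u p * deriv b p := by
      rw [EventuallyEq.deriv_eq hB]
      exact (hu'.fun_mul hb.differentiableAt.hasDerivAt).deriv
    rw [dA, dB, hAe.self_of_nhds, hB.self_of_nhds]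
    have e : u p * a p * (deriv u p * b p + u p * deriv b p) -
        (deriv u p * a p + u p * deriv a p) * (u p * b p) =
        u p ^ 2 * (a p * deriv b p - deriv a p * b p) := by ring
    rw [e]
    exact mul_ne_zero (pow_ne_zero 2 hu0) hW
  · intro p hp
    obtain ⟨a, b, u, ha, hb, hu, hu0, hW, hB, h⟩ := hloc p hp
    filter_upwards [hFA p hp, h, hB.filter_mono nhdsWithin_le_nhds,
      (hu.continuousAt.eventually_ne hu0).filter_mono nhdsWithin_le_nhds] with z h1 h2 h3 h4
    exact ⟨by rw [h3]; exact mul_ne_zero h4 h2.1, h1⟩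

/-- Multiplying both functions by χ leaves the quotient alone and multiplies the Wronskian W by χ²,
so χ is a square root of γ/W. -/
theorem exists_global_pair_wronskian {ρ : ℝ} (hρ : 0 < ρ) {F γ : ℂ → ℂ}
    (hF : ∀ p ∈ Metric.closedBall (0 : ℂ) ρ, LocalPair F p)
    (hγ : AnalyticOnNhd ℂ γ (Metric.ball 0 ρ)) (hγ0 : ∀ z ∈ Metric.ball (0 : ℂ) ρ, γ z ≠ 0) :
    ∃ a b : ℂ → ℂ, AnalyticOnNhd ℂ a (Metric.ball 0 ρ) ∧ AnalyticOnNhd ℂ b (Metric.ball 0 ρ) ∧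
      (∀ z ∈ Metric.ball (0 : ℂ) ρ, γ z = a z * deriv b z - deriv a z * b z) ∧
      ∀ p ∈ Metric.ball (0 : ℂ) ρ, ∀ᶠ z in 𝓝[≠] p, b z ≠ 0 ∧ F z * b z = a z := by
  obtain ⟨a, b, ha, hb, hW, h⟩ := exists_global_pair hF
  obtain ⟨χ, hχ, hχ2⟩ := exists_sq_eq hρ
    (δ := fun z => γ z / (a z * deriv b z - deriv a z * b z))
    (fun z hz => (hγ z hz).div (((ha z hz).mul (hb.deriv z hz)).sub
      ((ha.deriv z hz).mul (hb z hz))) (hW z hz))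
    (fun z hz => div_ne_zero (hγ0 z hz) (hW z hz))
  have hχ0 : ∀ z ∈ Metric.ball (0 : ℂ) ρ, χ z ≠ 0 := by
    intro z hz h0
    have := hχ2 z hz
    rw [h0] at this
    exact div_ne_zero (hγ0 z hz) (hW z hz) (by rw [← this]; ring)
  refine ⟨fun z => χ z * a z, fun z => χ z * b z, hχ.mul ha, hχ.mul hb, ?_, ?_⟩
  · intro z hz
    have h1 := (hχ z hz).differentiableAt.hasDerivAt
    rw [(h1.fun_mul (ha z hz).differentiableAt.hasDerivAt).deriv,
      (h1.fun_mul (hb z hz).differentiableAt.hasDerivAt).deriv]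
    have h2 := hχ2 z hz
    rw [eq_div_iff (hW z hz)] at h2
    linear_combination -h2
  · intro p hp
    filter_upwards [h p hp, ((hχ p hp).continuousAt.eventually_ne (hχ0 p hp)).filter_mono
      nhdsWithin_le_nhds] with z h1 h2
    refine ⟨mul_ne_zero h2 h1.1, ?_⟩
    rw [← h1.2]; ring

/-! ### Comparison of S_F and S_G; the criterion in the disc -/

/-- Since G' = -γ/w², its logarithmic derivative is γ'/γ - 2/w. Expressing S_G through γ'/γ lets it
cancel against the terms of S_F in W'/W when W = γ. -/
theorem schwarzian_of_deriv_eq {G γ : ℂ → ℂ} {z : ℂ} (hz : z ≠ 0) (hγ : AnalyticAt ℂ γ z)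
    (hγ0 : γ z ≠ 0) (hG : ∀ᶠ w in 𝓝 z, γ w = -w ^ 2 * deriv G w) :
    preSchwarzian G z = deriv γ z / γ z - 2 / z ∧
    schwarzian G z = deriv (fun w => deriv γ w / γ w) z + 2 / z ^ 2 -
      (1 / 2 : ℂ) * (deriv γ z / γ z - 2 / z) ^ 2 := by
  have hG' : ∀ᶠ w in 𝓝 z, deriv G w = -γ w / w ^ 2 := by
    filter_upwards [hG, eventually_ne_nhds hz] with w h1 h2
    rw [h1]; field_simp
  have e : ∀ᶠ w in 𝓝 z, preSchwarzian G w = deriv γ w / γ w - 2 / w := by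
    filter_upwards [hG'.eventually_nhds, eventually_ne_nhds hz,
      hγ.continuousAt.eventually_ne hγ0, hγ.eventually_analyticAt] with w h1 h2 h3 h4
    rw [preSchwarzian, EventuallyEq.deriv_eq h1, h1.self_of_nhds,
      ((h4.differentiableAt.hasDerivAt.fun_neg).fun_div (hasDerivAt_pow 2 w)
        (pow_ne_zero 2 h2)).deriv]
    field_simp
    push_cast
    ring
  refine ⟨e.self_of_nhds, ?_⟩
  have h1 : HasDerivAt (fun w : ℂ => 2 / w) (-2 / z ^ 2) z :=
    ((hasDerivAt_const z (2 : ℂ)).fun_div (hasDerivAt_id' z) hz).congr_deriv (by ring)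
  have h2 : DifferentiableAt ℂ (fun w => deriv γ w / γ w) z :=
    (hγ.deriv.div hγ hγ0).differentiableAt
  rw [schwarzian, EventuallyEq.deriv_eq e, e.self_of_nhds, (h2.hasDerivAt.fun_sub h1).deriv]
  ring

theorem LocalPair.eventually_analyticAt {F : ℂ → ℂ} {p : ℂ} (h : LocalPair F p) :
    ∀ᶠ z in 𝓝[≠] p, AnalyticAt ℂ F z := by
  obtain ⟨a, b, ha, hb, hW, hF⟩ := h
  filter_upwards [eventually_eventually_nhdsWithin.mpr hF, hF, self_mem_nhdsWithin,
    ha.eventually_analyticAt.filter_mono nhdsWithin_le_nhds,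
    hb.eventually_analyticAt.filter_mono nhdsWithin_le_nhds] with z h1 h2 h3 h5 h6
  rw [isOpen_compl_singleton.nhdsWithin_eq h3] at h1
  refine (h5.div h6 h2.1).congr ?_
  filter_upwards [h1] with w hw
  rw [Pi.div_apply, ← hw.2, mul_div_cancel_right₀ _ hw.1]

/-- Univalence in the disc `|z| < 1`, in the coordinate `z = 1 / ζ`. -/
theorem exists_injective_pair {F G k γ : ℂ → ℂ}
    (hF : ∀ p, ‖p‖ < 1 → LocalPair F p) (hG : ∀ p, ‖p‖ < 1 → LocalPair G p)
    (hGa : ∀ p, ‖p‖ < 1 → p ≠ 0 → AnalyticAt ℂ G p)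
    (hk : AnalyticOnNhd ℂ k (Metric.ball 0 1)) (hγ : AnalyticOnNhd ℂ γ (Metric.ball 0 1))
    (hk0 : k 0 = 1) (hk1 : deriv k 0 = 0) (hγ1 : deriv γ 0 = 0)
    (hkne : ∀ z, ‖z‖ < 1 → k z ≠ 0) (hγne : ∀ z, ‖z‖ < 1 → γ z ≠ 0)
    (hγG : ∀ z, ‖z‖ < 1 → z ≠ 0 → γ z = -z ^ 2 * deriv G z)
    (hbound : ∀ z, ‖z‖ < 1 → z ≠ 0 → AnalyticAt ℂ F z → AnalyticAt ℂ G z →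
      ‖(1 - k z) / k z -
        ((‖z‖ : ℂ) ^ 2 - 1) * (z * deriv k z / k z + (z * preSchwarzian G z + 2)) +
        ((‖z‖ : ℂ) ^ 2 - 1) ^ 2 *
          (k z * ((1 / 2 : ℂ) * z ^ 2 * (schwarzian F z - schwarzian G z)))‖ ≤ ‖z‖ ^ 2)
    {ρ : ℝ} (hρ0 : 0 < ρ) (hρ : ρ < 1) :
    ∃ a b : ℂ → ℂ, AnalyticOnNhd ℂ a (Metric.ball 0 ρ) ∧ AnalyticOnNhd ℂ b (Metric.ball 0 ρ) ∧
      (∀ z ∈ Metric.ball (0 : ℂ) ρ, a z * deriv b z - deriv a z * b z ≠ 0) ∧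
      (∀ p ∈ Metric.ball (0 : ℂ) ρ, ∀ᶠ z in 𝓝[≠] p, b z ≠ 0 ∧ F z * b z = a z) ∧
      ∀ x ∈ Metric.ball (0 : ℂ) ρ, ∀ y ∈ Metric.ball (0 : ℂ) ρ, a x * b y = a y * b x → x = y := by
  have hsub : Metric.ball (0 : ℂ) ρ ⊆ Metric.ball 0 1 := Metric.ball_subset_ball hρ.le
  have hlt : ∀ {z : ℂ}, z ∈ Metric.ball (0 : ℂ) 1 → ‖z‖ < 1 := fun hz => by simpa using hz
  have hmem : ∀ {z : ℂ}, ‖z‖ < 1 → z ∈ Metric.ball (0 : ℂ) 1 := fun hz => by simpa using hz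
  have hpunct : ∀ {p : ℂ} {U : Set ℂ}, IsOpen U → p ∈ U → ∀ᶠ z in 𝓝[≠] p, z ∈ U :=
    fun hU hp => mem_nhdsWithin_of_mem_nhds (hU.mem_nhds hp)
  have hne0 : ∀ p : ℂ, ∀ᶠ z in 𝓝[≠] p, z ≠ 0 := by
    intro p
    by_cases hp : p = 0
    · subst hp; exact self_mem_nhdsWithin
    · exact (eventually_ne_nhds hp).filter_mono nhdsWithin_le_nhds
  obtain ⟨Y, hY, hYe⟩ := exists_analyticOnNhd_of_locally Metric.isOpen_ball (U := Metric.ball 0 1)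
    (ψ := fun z => (1 / 2 : ℂ) * z ^ 2 * (schwarzian F z - schwarzian G z)) (by
      intro p hp
      obtain ⟨T, hT, hTe⟩ := (hF p (hlt hp)).exists_analyticAt_schwarzian
      obtain ⟨T', hT', hTe'⟩ := (hG p (hlt hp)).exists_analyticAt_schwarzian
      refine ⟨fun z => (1 / 2 : ℂ) * z ^ 2 * (T z - T' z),
        (analyticAt_const.mul (analyticAt_id.pow 2)).mul (hT.sub hT'), ?_⟩
      filter_upwards [hTe, hTe'] with z h1 h2
      rw [h1, h2])
  obtain ⟨a, b, ha, hb, hW, hFab⟩ := exists_global_pair_wronskian hρ0 (F := F) (γ := γ)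
    (fun p hp => hF p (lt_of_le_of_lt (by simpa using hp) hρ)) (hγ.mono hsub)
    (fun z hz => hγne z (hlt (hsub hz)))
  refine ⟨a, b, ha, hb, fun z hz => hW z hz ▸ hγne z (hlt (hsub hz)), hFab, ?_⟩
  have hγev : ∀ z ∈ Metric.ball (0 : ℂ) 1, z ≠ 0 → ∀ᶠ w in 𝓝 z, γ w = -w ^ 2 * deriv G w := by
    intro z hz hz0
    filter_upwards [Metric.isOpen_ball.mem_nhds hz, eventually_ne_nhds hz0] with w h1 h2
    exact hγG w (hlt h1) h2
  -- With the common Wronskian γ, the difference S_F - S_G is 2(a'b'' - a''b')/γ - 2γ'/(zγ) off the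
  -- exceptional points; continuity covers the rest.
  have hYγ : ∀ z ∈ Metric.ball (0 : ℂ) ρ, Y z * γ z = z ^ 2 * (deriv a z * deriv (deriv b) z -
      deriv (deriv a) z * deriv b z) - z * deriv γ z := by
    intro p hp
    have hγp := hγ p (hsub hp)
    refine eq_at_of_eventuallyEq_punctured (p := p) (f := fun z => Y z * γ z)
      (g := fun z => z ^ 2 * (deriv a z * deriv (deriv b) z -
        deriv (deriv a) z * deriv b z) - z * deriv γ z)
      ((hY p (hsub hp)).mul hγp).continuousAt
      (((analyticAt_id.pow 2).mul (((ha.deriv p hp).mul (hb.deriv.deriv p hp)).sub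
        ((ha.deriv.deriv p hp).mul (hb.deriv p hp)))).sub
        (analyticAt_id.mul hγp.deriv)).continuousAt ?_
    filter_upwards [hYe p (hsub hp), hFab p hp, eventually_eventually_nhdsWithin.mpr (hFab p hp),
      self_mem_nhdsWithin, hne0 p, hpunct Metric.isOpen_ball hp] with z h1 h2 h3 h4 h5 h6
    rw [isOpen_compl_singleton.nhdsWithin_eq h4] at h3
    have hγz := hγne z (hlt (hsub h6))
    have hP : ∀ᶠ w in 𝓝 z, (a w * deriv (deriv b) w - deriv (deriv a) w * b w) /
        (a w * deriv b w - deriv a w * b w) = deriv γ w / γ w := by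
      filter_upwards [Metric.isOpen_ball.mem_nhds h6] with w hw
      have e : γ =ᶠ[𝓝 w] fun w => a w * deriv b w - deriv a w * b w := by
        filter_upwards [Metric.isOpen_ball.mem_nhds hw] with x hx using hW x hx
      have d : ∀ {f : ℂ → ℂ}, AnalyticOnNhd ℂ f (Metric.ball 0 ρ) → HasDerivAt f (deriv f w) w :=
        fun hf => (hf w hw).differentiableAt.hasDerivAt
      rw [e.deriv_eq, ← hW w hw,
        (((d ha).fun_mul (d hb.deriv)).fun_sub ((d ha.deriv).fun_mul (d hb))).deriv]
      ring
    have hWz := hW z h6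
    have hSF := schwarzian_of_eventuallyEq_div (ha z h6) (hb z h6) h2.1 (hWz ▸ hγz)
      (h3.mono fun w hw => hw.2)
    have hSG := (schwarzian_of_deriv_eq h5 (hγ z (hsub h6)) hγz (hγev z (hsub h6) h5)).2
    rw [EventuallyEq.deriv_eq hP, hP.self_of_nhds, ← hWz] at hSF
    rw [← h1, hSF, hSG]
    field_simp
    ring
  -- The assumed bound holds only where F is analytic. With Y in place of the Schwarzian difference
  -- both sides are continuous, so it passes to the poles of F.
  have hbY : ∀ z, ‖z‖ < 1 → z ≠ 0 → ‖(1 - k z) / k z -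
      ((‖z‖ : ℂ) ^ 2 - 1) * (z * deriv k z / k z + z * deriv γ z / γ z) +
      ((‖z‖ : ℂ) ^ 2 - 1) ^ 2 * (k z * Y z)‖ ≤ ‖z‖ ^ 2 := by
    intro p hp hp0
    have hp' := hmem hp
    have c1 := (hk p hp').continuousAt
    have c2 := (hk.deriv p hp').continuousAt
    have c3 := (hγ p hp').continuousAt
    have c4 := (hγ.deriv p hp').continuousAt
    have c5 := (hY p hp').continuousAt
    have n1 := hkne p hp
    have n2 := hγne p hp
    have hc : ContinuousAt (fun z => ‖(1 - k z) / k z -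
      ((‖z‖ : ℂ) ^ 2 - 1) * (z * deriv k z / k z + z * deriv γ z / γ z) +
      ((‖z‖ : ℂ) ^ 2 - 1) ^ 2 * (k z * Y z)‖) p := by
      fun_prop (disch := assumption)
    refine le_of_tendsto_of_tendsto (hc.tendsto.mono_left nhdsWithin_le_nhds)
      ((continuous_norm.pow 2).continuousAt.tendsto.mono_left (nhdsWithin_le_nhds (s := {p}ᶜ))) ?_
    filter_upwards [(hF p hp).eventually_analyticAt, hYe p hp', hne0 p,
      hpunct Metric.isOpen_ball hp'] with z h1 h2 h3 h4
    have h5 := hbound z (hlt h4) h3 h1 (hGa z (hlt h4) h3)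
    rw [h2, (schwarzian_of_deriv_eq h3 (hγ z h4) (hγne z (hlt h4)) (hγev z h4 h3)).1] at h5
    have e : z * (deriv γ z / γ z - 2 / z) + 2 = z * deriv γ z / γ z := by
      field_simp; ring
    rwa [e] at h5
  intro x hx y hy hxy
  exact parallel_imp_eq_of_wronskian hρ0 hρ.le ha hb hk hγ hY hk0 hk1 hγ1 hkne hγne
    (fun z hz => hW z (by simpa using hz)) (fun z hz => hYγ z (by simpa using hz)) hbY
    (by simpa using hx) (by simpa using hy) hxy

/-! ### Injectivity near a point and local pairs -/

/-- Near p the quotient g/g(p) is close to 1, so its principal logarithm is analytic and may be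
divided by n. -/
theorem AnalyticAt.exists_pow_eq {g : ℂ → ℂ} {p : ℂ} (hg : AnalyticAt ℂ g p) (hgp : g p ≠ 0)
    {n : ℕ} (hn : n ≠ 0) :
    ∃ r : ℂ → ℂ, AnalyticAt ℂ r p ∧ r p ≠ 0 ∧ ∀ᶠ z in 𝓝 p, r z ^ n = g z := by
  obtain ⟨c, hc⟩ := IsAlgClosed.exists_pow_nat_eq (g p) (Nat.pos_of_ne_zero hn)
  have hc0 : c ≠ 0 := by rintro rfl; exact hgp (by rw [← hc, zero_pow hn])
  have hl : AnalyticAt ℂ (fun z => Complex.log (g z / g p)) p :=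
    (hg.fun_div analyticAt_const hgp).clog (by simp [hgp])
  refine ⟨fun z => c * Complex.exp (Complex.log (g z / g p) / n),
    analyticAt_const.mul (hl.div_const).cexp, mul_ne_zero hc0 (Complex.exp_ne_zero _), ?_⟩
  filter_upwards [hg.continuousAt.eventually_ne hgp] with z hz
  have hn' : (n : ℂ) ≠ 0 := by exact_mod_cast hn
  rw [mul_pow, hc, ← Complex.exp_nat_mul, mul_div_cancel₀ _ hn',
    Complex.exp_log (div_ne_zero hz hgp)]
  field_simp

/-- If the derivative vanished, f - f(p) would be the n-th power of a local coordinate with n ≥ 2.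
For a primitive n-th root of unity ω, the points with coordinates e and ωe are distinct and share a
value. -/
theorem AnalyticAt.deriv_ne_zero_of_injOn {f : ℂ → ℂ} {p : ℂ} (hf : AnalyticAt ℂ f p)
    {V : Set ℂ} (hV : V ∈ 𝓝 p) (hinj : Set.InjOn f V) : deriv f p ≠ 0 := by
  intro hd
  have hf1 : AnalyticAt ℂ (fun z => f z - f p) p := hf.sub analyticAt_const
  have htop : analyticOrderAt (fun z => f z - f p) p ≠ ⊤ := by
    rw [Ne, analyticOrderAt_eq_top]
    intro h
    have h1 : ∀ᶠ z in 𝓝[≠] p, False := by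
      filter_upwards [h.filter_mono nhdsWithin_le_nhds, self_mem_nhdsWithin,
        mem_nhdsWithin_of_mem_nhds hV] with z h1 h2 h3
      exact h2 (hinj h3 (mem_of_mem_nhds hV) (sub_eq_zero.mp h1))
    exact h1.exists.elim fun _ h => h
  obtain ⟨g, hg, hgp, hfg⟩ := hf1.analyticOrderAt_ne_top.mp htop
  set n := analyticOrderNatAt (fun z => f z - f p) p
  simp only [smul_eq_mul] at hfg
  have hn0 : n ≠ 0 := by
    intro h
    have := hfg.self_of_nhds
    simp [h] at this
    exact hgp this.symm
  have hn1 : n ≠ 1 := by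
    intro h
    have h1 : deriv (fun z => f z - f p) p = g p := by
      rw [hfg.deriv_eq, h]
      have := ((((hasDerivAt_id' p).sub_const p).fun_pow 1).fun_mul
        hg.differentiableAt.hasDerivAt).deriv
      simpa using this
    rw [deriv_sub_const, hd] at h1
    exact hgp h1.symm
  obtain ⟨r, hr, hrp, hrg⟩ := hg.exists_pow_eq hgp hn0
  have hφ : HasStrictDerivAt (fun z => (z - p) * r z) (r p) p := by
    have h0 : HasStrictDerivAt (fun z => z - p) 1 p := (hasStrictDerivAt_id p).sub_const p
    simpa using HasStrictDerivAt.fun_mul h0 hr.hasStrictDerivAt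
  have hmap := hφ.map_nhds_eq hrp
  simp only [sub_self, zero_mul] at hmap
  obtain ⟨ω, hω⟩ : ∃ ω : ℂ, IsPrimitiveRoot ω n := ⟨_, Complex.isPrimitiveRoot_exp n hn0⟩
  have hω1 : ω ≠ 1 := hω.ne_one (by omega)
  have hU : V ∩ {z | f z - f p = ((z - p) * r z) ^ n} ∈ 𝓝 p := by
    refine inter_mem hV ?_
    filter_upwards [hfg, hrg] with z h1 h2
    rw [h1, mul_pow, h2]
  have hS : (fun z => (z - p) * r z) '' (V ∩ {z | f z - f p = ((z - p) * r z) ^ n}) ∈ 𝓝 (0 : ℂ) := by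
    rw [← hmap]; exact image_mem_map hU
  have hS' : ∀ᶠ e in 𝓝 (0 : ℂ), ω * e ∈
      (fun z => (z - p) * r z) '' (V ∩ {z | f z - f p = ((z - p) * r z) ^ n}) := by
    have : Tendsto (fun e : ℂ => ω * e) (𝓝 0) (𝓝 0) := by
      have : Continuous fun e : ℂ => ω * e := by fun_prop
      simpa using this.tendsto 0
    exact this.eventually hS
  have h1 : ∀ᶠ e in 𝓝[≠] (0 : ℂ), e ∈ (fun z => (z - p) * r z) ''
      (V ∩ {z | f z - f p = ((z - p) * r z) ^ n}) ∧ ω * e ∈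
      (fun z => (z - p) * r z) '' (V ∩ {z | f z - f p = ((z - p) * r z) ^ n}) ∧ e ≠ 0 := by
    filter_upwards [mem_nhdsWithin_of_mem_nhds hS, hS'.filter_mono nhdsWithin_le_nhds,
      self_mem_nhdsWithin] with e h1 h2 h3
    exact ⟨h1, h2, h3⟩
  obtain ⟨e, ⟨x, ⟨hxV, hx⟩, hxe⟩, ⟨y, ⟨hyV, hy⟩, hye⟩, he⟩ := h1.exists
  simp only [Set.mem_ofPred_eq] at hx hy hxe hye
  have hxy : f x = f y := by
    rw [hxe] at hx
    rw [hye, mul_pow, hω.pow_eq_one, one_mul] at hy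
    linear_combination hx - hy
  have := hinj hxV hyV hxy
  rw [← this, hxe] at hye
  exact hω1 (mul_right_cancel₀ he (by rw [one_mul]; exact hye.symm))

/-- Where f is analytic the pair is (f, 1); at a pole it is (1, 1/f). The Wronskian is, up to sign,
the derivative of an injective analytic function. -/
theorem localPair_of_univalentOn {f : ℂ → ℂ} {p : ℂ} (hf : MeromorphicNFAt f p) {V : Set ℂ}
    (hV : V ∈ 𝓝 p) (hinj : UnivalentOn f V) : LocalPair f p := by
  by_cases hfa : AnalyticAt ℂ f p
  · have hinj' : Set.InjOn f (V ∩ {z | AnalyticAt ℂ f z}) := by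
      intro x hx y hy hxy
      have hnp : ∀ z, AnalyticAt ℂ f z → ¬ IsPoleAt f z :=
        fun z hz => not_lt.mpr hz.meromorphicOrderAt_nonneg
      refine hinj hx.1 hy.1 ?_
      rw [sphereValue, sphereValue, if_neg (hnp x hx.2), if_neg (hnp y hy.2), hxy]
    have := hfa.deriv_ne_zero_of_injOn (inter_mem hV hfa.eventually_analyticAt) hinj'
    exact ⟨f, fun _ => 1, hfa, analyticAt_const, by simpa using this, by simp⟩
  · have hpole : meromorphicOrderAt f p < 0 := by
      by_contra h
      exact hfa (hf.meromorphicOrderAt_nonneg_iff_analyticAt.mp (not_lt.mp h))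
    -- The normal form assigns 0 at a pole, and the inverse of 0 is 0, so `f⁻¹` has its correct
    -- value at p.
    have hfp : f p = 0 := by
      rcases meromorphicNFAt_iff_analyticAt_or.mp hf with h | h
      · exact absurd h hfa
      · exact h.2.2
    have hinv : AnalyticAt ℂ f⁻¹ p := by
      refine hf.inv.meromorphicOrderAt_nonneg_iff_analyticAt.mp ?_
      rw [meromorphicOrderAt_inv]
      cases h : meromorphicOrderAt f p with
      | top => simp [h] at hpole
      | coe m =>
        rw [h] at hpole
        have : m < 0 := by exact_mod_cast hpole
        have h2 : (0 : ℤ) ≤ -m := by omega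
        exact_mod_cast h2
    have hana : ∀ᶠ z in 𝓝[≠] p, AnalyticAt ℂ f z := hf.meromorphicAt.eventually_analyticAt
    have hnz : ∀ᶠ z in 𝓝[≠] p, f z ≠ 0 :=
      (meromorphicOrderAt_ne_top_iff_eventually_ne_zero hf.meromorphicAt).mp
        (ne_top_of_lt hpole)
    have hW : ∀ᶠ z in 𝓝 p, z = p ∨ AnalyticAt ℂ f z ∧ f z ≠ 0 := by
      have := hana.and hnz
      rw [eventually_nhdsWithin_iff] at this
      filter_upwards [this] with z hz
      by_cases h : z = p
      · exact Or.inl h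
      · exact Or.inr (hz h)
    have hinj' : Set.InjOn f⁻¹ (V ∩ {z | z = p ∨ AnalyticAt ℂ f z ∧ f z ≠ 0}) := by
      intro x hx y hy hxy
      have hxy' : f x = f y := inv_injective hxy
      rcases hx.2 with hx2 | hx2 <;> rcases hy.2 with hy2 | hy2
      · rw [hx2, hy2]
      · rw [hx2, hfp] at hxy'; exact absurd hxy'.symm hy2.2
      · rw [hy2, hfp] at hxy'; exact absurd hxy' hx2.2
      · have hnp : ∀ z, AnalyticAt ℂ f z → ¬ IsPoleAt f z :=
          fun z hz => not_lt.mpr hz.meromorphicOrderAt_nonneg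
        refine hinj hx.1 hy.1 ?_
        rw [sphereValue, sphereValue, if_neg (hnp x hx2.1), if_neg (hnp y hy2.1), hxy']
    have hd := hinv.deriv_ne_zero_of_injOn (inter_mem hV hW) hinj'
    refine ⟨fun _ => 1, f⁻¹, analyticAt_const, hinv, by simpa using hd, ?_⟩
    filter_upwards [hnz] with z hz
    exact ⟨inv_ne_zero hz, mul_inv_cancel₀ hz⟩

/-! ### The inversion z = 1/ζ -/

theorem LocalPair.comp_inv {f : ℂ → ℂ} {p : ℂ} (hp : p ≠ 0) (h : LocalPair f p⁻¹) :
    LocalPair (fun z => f z⁻¹) p := by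
  obtain ⟨a, b, ha, hb, hW, hab⟩ := h
  have hi : AnalyticAt ℂ (fun z : ℂ => z⁻¹) p := analyticAt_inv hp
  have hd := hasDerivAt_inv hp
  refine ⟨fun z => a z⁻¹, fun z => b z⁻¹, ha.comp_of_eq hi rfl, hb.comp_of_eq hi rfl, ?_, ?_⟩
  · have e1 : deriv (fun z => a z⁻¹) p = deriv a p⁻¹ * -(p ^ 2)⁻¹ :=
      (ha.differentiableAt.hasDerivAt.comp p hd).deriv
    have e2 : deriv (fun z => b z⁻¹) p = deriv b p⁻¹ * -(p ^ 2)⁻¹ :=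
      (hb.differentiableAt.hasDerivAt.comp p hd).deriv
    rw [e1, e2]
    have : a p⁻¹ * (deriv b p⁻¹ * -(p ^ 2)⁻¹) - deriv a p⁻¹ * -(p ^ 2)⁻¹ * b p⁻¹ =
      -(p ^ 2)⁻¹ * (a p⁻¹ * deriv b p⁻¹ - deriv a p⁻¹ * b p⁻¹) := by ring
    rw [this]
    exact mul_ne_zero (neg_ne_zero.mpr (inv_ne_zero (pow_ne_zero 2 hp))) hW
  · have ht : Tendsto (fun z : ℂ => z⁻¹) (𝓝[≠] p) (𝓝[≠] p⁻¹) :=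
      tendsto_nhdsWithin_iff.mpr ⟨hi.continuousAt.tendsto.mono_left nhdsWithin_le_nhds, by
        filter_upwards [self_mem_nhdsWithin] with z hz h
        exact hz (inv_injective h)⟩
    exact ht.eventually hab

/-- Inversion is a Möbius map, so it has no Schwarzian of its own and contributes only the squared
derivative z⁻⁴. -/
theorem schwarzian_comp_inv {f : ℂ → ℂ} {z : ℂ} (hz : z ≠ 0) (hf : AnalyticAt ℂ f z⁻¹)
    (hf' : deriv f z⁻¹ ≠ 0) :
    preSchwarzian (fun w => f w⁻¹) z = -(preSchwarzian f z⁻¹) / z ^ 2 - 2 / z ∧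
    schwarzian (fun w => f w⁻¹) z = schwarzian f z⁻¹ / z ^ 4 := by
  have hcomp : ∀ {φ : ℂ → ℂ} {w : ℂ}, w ≠ 0 → AnalyticAt ℂ φ w⁻¹ →
      HasDerivAt (fun w => φ w⁻¹) (-deriv φ w⁻¹ / w ^ 2) w := by
    intro φ w hw hφ
    exact (hφ.differentiableAt.hasDerivAt.comp w (hasDerivAt_inv hw)).congr_deriv (by ring)
  have hci : ContinuousAt (fun w : ℂ => w⁻¹) z := continuousAt_inv₀ hz
  have hnear : ∀ᶠ w in 𝓝 z, w ≠ 0 ∧ AnalyticAt ℂ f w⁻¹ ∧ deriv f w⁻¹ ≠ 0 := by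
    filter_upwards [eventually_ne_nhds hz, hci.eventually hf.eventually_analyticAt,
      hci.eventually (hf.deriv.continuousAt.eventually_ne hf')] with w h1 h2 h3
    exact ⟨h1, h2, h3⟩
  have e1 : ∀ᶠ w in 𝓝 z, deriv (fun w => f w⁻¹) w = -deriv f w⁻¹ / w ^ 2 :=
    hnear.mono fun w hw => (hcomp hw.1 hw.2.1).deriv
  have e2 : ∀ᶠ w in 𝓝 z, preSchwarzian (fun w => f w⁻¹) w =
      -(preSchwarzian f w⁻¹) / w ^ 2 - 2 / w := by
    filter_upwards [e1.eventually_nhds, hnear] with w h1 ⟨h2, h3, h4⟩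
    rw [preSchwarzian, EventuallyEq.deriv_eq h1, h1.self_of_nhds,
      (((hcomp h2 h3.deriv).fun_neg).fun_div (hasDerivAt_pow 2 w) (pow_ne_zero 2 h2)).deriv,
      preSchwarzian]
    generalize deriv f w⁻¹ = D at h4 ⊢
    field_simp
    push_cast
    ring
  refine ⟨e2.self_of_nhds, ?_⟩
  have hpa : AnalyticAt ℂ (preSchwarzian f) z⁻¹ := hf.deriv.deriv.div hf.deriv hf'
  have h1 : HasDerivAt (fun w : ℂ => 2 / w) (-2 / z ^ 2) z :=
    ((hasDerivAt_const z (2 : ℂ)).fun_div (hasDerivAt_id' z) hz).congr_deriv (by ring)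
  rw [schwarzian, EventuallyEq.deriv_eq e2, e2.self_of_nhds,
    ((((hcomp hz hpa).fun_neg).fun_div (hasDerivAt_pow 2 z) (pow_ne_zero 2 hz)).fun_sub h1).deriv,
    schwarzian]
  field_simp
  push_cast
  ring

/-! ### Behaviour at infinity -/

theorem exists_analyticAt_of_hasSum {a : ℕ → ℂ} {φ : ℂ → ℂ}
    (h : ∀ᶠ ζ in Bornology.cobounded ℂ, HasSum (fun n : ℕ => a n / ζ ^ n) (φ ζ)) :
    ∃ A : ℂ → ℂ, AnalyticAt ℂ A 0 ∧ A 0 = a 0 ∧ deriv A 0 = a 1 ∧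
      ∀ᶠ z in 𝓝[≠] (0 : ℂ), φ z⁻¹ = A z := by
  have h1 : ∀ᶠ z in 𝓝[≠] (0 : ℂ), HasSum (fun n : ℕ => a n / z⁻¹ ^ n) (φ z⁻¹) :=
    tendsto_inv₀_nhdsNE_zero.eventually h
  have hp : HasFPowerSeriesAt (fun z => if z = 0 then a 0 else φ z⁻¹)
      (FormalMultilinearSeries.ofScalars ℂ a) 0 := by
    rw [hasFPowerSeriesAt_iff]
    rw [eventually_nhdsWithin_iff] at h1
    filter_upwards [h1] with z hz
    simp only [FormalMultilinearSeries.coeff_ofScalars, smul_eq_mul, zero_add]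
    by_cases h0 : z = 0
    · rw [if_pos h0, h0]
      simpa using hasSum_single (f := fun n : ℕ => (0 : ℂ) ^ n * a n) 0
        (fun n hn => by simp [hn])
    · rw [if_neg h0]
      refine (hz h0).congr_fun ?_
      intro n
      simp [div_eq_mul_inv, mul_comm]
  refine ⟨_, hp.analyticAt, by simp, ?_, ?_⟩
  · rw [hp.deriv]
    simp [FormalMultilinearSeries.ofScalars]
  · filter_upwards [self_mem_nhdsWithin] with z hz
    have hz' : z ≠ 0 := hz
    rw [if_neg hz']

/-- Write the expression as X + |z|²R with X = A - B + C analytic. The bound makes X = O(|z|²), so X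
= z²g. Dividing by |z|² along z = tv, t → 0, gives |v²g(0) + B(0) - 2C(0)| ≤ 1 for every unit v;
averaging v = 1 and v = i removes g(0). -/
theorem bounds_of_quadratic_bound {A B C : ℂ → ℂ} (hA : AnalyticAt ℂ A 0) (hB : AnalyticAt ℂ B 0)
    (hC : AnalyticAt ℂ C 0)
    (h : ∀ᶠ z in 𝓝[≠] (0 : ℂ),
      ‖A z + ((‖z‖ : ℂ) ^ 2 - 1) * B z + ((‖z‖ : ℂ) ^ 2 - 1) ^ 2 * C z‖ ≤ ‖z‖ ^ 2) :
    A 0 - B 0 + C 0 = 0 ∧ ‖B 0 - 2 * C 0‖ ≤ 1 := by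
  have hX : AnalyticAt ℂ (fun z => A z - B z + C z) 0 := (hA.sub hB).add hC
  have hR : ContinuousAt (fun z : ℂ => B z - 2 * C z + (‖z‖ : ℂ) ^ 2 * C z) 0 := by
    have := hB.continuousAt
    have := hC.continuousAt
    fun_prop
  have hsplit : ∀ z : ℂ, A z + ((‖z‖ : ℂ) ^ 2 - 1) * B z + ((‖z‖ : ℂ) ^ 2 - 1) ^ 2 * C z =
      (A z - B z + C z) + (‖z‖ : ℂ) ^ 2 * (B z - 2 * C z + (‖z‖ : ℂ) ^ 2 * C z) := by
    intro z; ring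
  have hfull : ContinuousAt (fun z : ℂ =>
      ‖A z + ((‖z‖ : ℂ) ^ 2 - 1) * B z + ((‖z‖ : ℂ) ^ 2 - 1) ^ 2 * C z‖) 0 := by
    have := hA.continuousAt
    have := hB.continuousAt
    have := hC.continuousAt
    fun_prop
  have h0 : A 0 - B 0 + C 0 = 0 := by
    have h1 := le_of_tendsto_of_tendsto (hfull.tendsto.mono_left nhdsWithin_le_nhds)
      ((continuous_norm.pow 2).continuousAt.tendsto.mono_left
        (nhdsWithin_le_nhds (a := (0 : ℂ)) (s := {0}ᶜ))) h
    rw [hsplit] at h1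
    simpa using h1
  refine ⟨h0, ?_⟩
  have h' : ∀ᶠ z in 𝓝 (0 : ℂ),
      ‖A z + ((‖z‖ : ℂ) ^ 2 - 1) * B z + ((‖z‖ : ℂ) ^ 2 - 1) ^ 2 * C z‖ ≤ ‖z‖ ^ 2 := by
    rw [eventually_nhdsWithin_iff] at h
    filter_upwards [h] with z hz
    by_cases hz0 : z = 0
    · rw [hsplit, hz0, h0]; simp
    · exact hz hz0
  have hbig : (fun z => A z - B z + C z) =O[𝓝 0] fun z : ℂ => ‖z - 0‖ ^ 2 := by
    have hM := hR.norm.eventually (gt_mem_nhds (lt_add_one _))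
    refine Asymptotics.IsBigO.of_bound
      (1 + (‖B 0 - 2 * C 0 + (‖(0 : ℂ)‖ : ℂ) ^ 2 * C 0‖ + 1)) ?_
    filter_upwards [h', hM] with z h1 h2
    rw [hsplit] at h1
    have h3 := norm_sub_le ((A z - B z + C z) + (‖z‖ : ℂ) ^ 2 *
      (B z - 2 * C z + (‖z‖ : ℂ) ^ 2 * C z)) ((‖z‖ : ℂ) ^ 2 *
      (B z - 2 * C z + (‖z‖ : ℂ) ^ 2 * C z))
    rw [add_sub_cancel_right, norm_mul ((‖z‖ : ℂ) ^ 2), norm_pow, Complex.norm_real,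
      norm_norm] at h3
    simp only [sub_zero, norm_pow, norm_norm]
    nlinarith [sq_nonneg ‖z‖]
  have hd : deriv (fun z => A z - B z + C z) 0 = 0 := by
    have := (hbig.hasFDerivAt (𝕜 := ℂ) one_lt_two).hasDerivAt.deriv
    simpa using this
  obtain ⟨U, hU, hUo, h0U⟩ := eventually_nhds_iff.mp hX.eventually_analyticAt
  obtain ⟨g, hg, hXg⟩ := exists_eq_sq_mul hUo h0U hU h0 hd
  have hgc : ContinuousAt g 0 := (hg 0 h0U).continuousAt
  have key : ∀ v : ℂ, ‖v‖ = 1 → ‖v ^ 2 * g 0 + (B 0 - 2 * C 0)‖ ≤ 1 := by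
    intro v hv
    have ht : Tendsto (fun t : ℝ => (t : ℂ) * v) (𝓝[>] 0) (𝓝 0) := by
      have : Continuous fun t : ℝ => (t : ℂ) * v := by fun_prop
      have h1 := this.tendsto 0
      simp only [Complex.ofReal_zero, zero_mul] at h1
      exact h1.mono_left nhdsWithin_le_nhds
    have hlim : Tendsto (fun t : ℝ => ‖v ^ 2 * g (t * v) + (B (t * v) - 2 * C (t * v) +
        (‖(t : ℂ) * v‖ : ℂ) ^ 2 * C (t * v))‖) (𝓝[>] 0)
        (𝓝 ‖v ^ 2 * g 0 + (B 0 - 2 * C 0 + (‖(0 : ℂ)‖ : ℂ) ^ 2 * C 0)‖) :=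
      (((hgc.tendsto.comp ht).const_mul _).add (hR.tendsto.comp ht)).norm
    have h2 := le_of_tendsto hlim (b := 1) (by
      filter_upwards [ht.eventually h', self_mem_nhdsWithin] with t h1 ht0
      have ht0' : 0 < t := ht0
      rw [hsplit, hXg] at h1
      have hn : ‖(t : ℂ) * v‖ = t := by
        rw [norm_mul, hv, mul_one, Complex.norm_real, Real.norm_of_nonneg ht0'.le]
      have e : ((t : ℂ) * v) ^ 2 * g (t * v) + (‖(t : ℂ) * v‖ : ℂ) ^ 2 * (B (t * v) -
          2 * C (t * v) + (‖(t : ℂ) * v‖ : ℂ) ^ 2 * C (t * v)) = (t : ℂ) ^ 2 *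
          (v ^ 2 * g (t * v) + (B (t * v) - 2 * C (t * v) +
        (‖(t : ℂ) * v‖ : ℂ) ^ 2 * C (t * v))) := by
        rw [hn]; ring
      rw [e, norm_mul, norm_pow, Complex.norm_real, Real.norm_of_nonneg ht0'.le, hn] at h1
      rw [hn]
      exact le_of_mul_le_mul_left (by simpa using h1) (pow_pos ht0' 2))
    simpa using h2
  have k1 := key 1 (by simp)
  have k2 := key Complex.I (by simp)
  rw [one_pow, one_mul] at k1
  rw [Complex.I_sq] at k2
  have := norm_add_le (g 0 + (B 0 - 2 * C 0)) (-1 * g 0 + (B 0 - 2 * C 0))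
  rw [show g 0 + (B 0 - 2 * C 0) + (-1 * g 0 + (B 0 - 2 * C 0)) = 2 * (B 0 - 2 * C 0) by ring,
    norm_mul, Complex.norm_ofNat] at this
  linarith

/-- Behaviour of the (pre-)Schwarzian at the origin of a function `b / z + A(z)`. -/
theorem exists_order_data {F A : ℂ → ℂ} {b : ℂ} (hA : AnalyticAt ℂ A 0)
    (hF : ∀ᶠ z in 𝓝[≠] (0 : ℂ), F z = b * z⁻¹ + A z)
    (hF' : ∀ᶠ z in 𝓝[≠] (0 : ℂ), deriv F z ≠ 0) :
    ∃ (n : ℕ) (φ β T : ℂ → ℂ), AnalyticAt ℂ φ 0 ∧ φ 0 ≠ 0 ∧ AnalyticAt ℂ β 0 ∧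
      AnalyticAt ℂ T 0 ∧ T 0 = n - n ^ 2 / 2 ∧
      (∀ᶠ z in 𝓝 (0 : ℂ), b - z ^ 2 * deriv A z = z ^ n * φ z) ∧
      ∀ᶠ z in 𝓝[≠] (0 : ℂ), z * preSchwarzian F z + 2 = n + z * β z ∧
        z ^ 2 * schwarzian F z = T z := by
  -- This is -z²F' off the origin. If n is its order, F' behaves like z^(n-2), which makes n - n²/2
  -- the leading coefficient of z²S_F.
  let γ : ℂ → ℂ := fun z => b - z ^ 2 * deriv A z
  have hγ : AnalyticAt ℂ γ 0 := analyticAt_const.sub ((analyticAt_id.pow 2).mul hA.deriv)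
  have hγF : ∀ᶠ z in 𝓝[≠] (0 : ℂ), γ z = -z ^ 2 * deriv F z := by
    filter_upwards [eventually_eventually_nhdsWithin.mpr hF, self_mem_nhdsWithin,
      hA.eventually_analyticAt.filter_mono nhdsWithin_le_nhds] with z h1 h2 h3
    rw [isOpen_compl_singleton.nhdsWithin_eq h2] at h1
    have hz : z ≠ 0 := h2
    rw [EventuallyEq.deriv_eq h1, (((hasDerivAt_inv hz).const_mul b).fun_add
      h3.differentiableAt.hasDerivAt).deriv]
    simp only [γ]
    field_simp
    ring
  have hγne : ∀ᶠ z in 𝓝[≠] (0 : ℂ), γ z ≠ 0 := by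
    filter_upwards [hγF, hF', self_mem_nhdsWithin] with z h1 h2 h3
    rw [h1]
    exact mul_ne_zero (neg_ne_zero.mpr (pow_ne_zero 2 h3)) h2
  have htop : analyticOrderAt γ 0 ≠ ⊤ := by
    rw [Ne, analyticOrderAt_eq_top]
    intro h
    obtain ⟨z, h1, h2⟩ := ((h.filter_mono nhdsWithin_le_nhds).and hγne).exists
    exact h2 h1
  obtain ⟨φ, hφ, hφ0, hγφ⟩ := hγ.analyticOrderAt_ne_top.mp htop
  set n := analyticOrderNatAt γ 0
  simp only [smul_eq_mul, sub_zero] at hγφ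
  let β : ℂ → ℂ := fun z => deriv φ z / φ z
  have hβ : AnalyticAt ℂ β 0 := hφ.deriv.div hφ hφ0
  let T : ℂ → ℂ := fun z => -n + 2 - (1 / 2 : ℂ) * ((n - 2) + z * β z) ^ 2 + z ^ 2 * deriv β z
  have hT : AnalyticAt ℂ T 0 := by
    have := hβ.deriv
    have h2 : AnalyticAt ℂ β 0 := hβ
    fun_prop
  refine ⟨n, φ, β, T, hφ, hφ0, hβ, hT, by simp [T]; ring, hγφ, ?_⟩
  filter_upwards [eventually_eventually_nhdsWithin.mpr hγF, self_mem_nhdsWithin, hγne,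
    hγ.eventually_analyticAt.filter_mono nhdsWithin_le_nhds,
    hφ.eventually_analyticAt.filter_mono nhdsWithin_le_nhds,
    hβ.eventually_analyticAt.filter_mono nhdsWithin_le_nhds,
    (hφ.continuousAt.eventually_ne hφ0).eventually_nhds.filter_mono nhdsWithin_le_nhds,
    hγφ.eventually_nhds.filter_mono nhdsWithin_le_nhds] with z h1 h2 h3 h4 h5 h6 h7 h8
  rw [isOpen_compl_singleton.nhdsWithin_eq h2] at h1
  have hz : z ≠ 0 := h2
  have hP : ∀ᶠ w in 𝓝 z, deriv γ w / γ w = n / w + β w := by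
    filter_upwards [h8.eventually_nhds, h7, h5.eventually_analyticAt, eventually_ne_nhds hz]
      with w e1 e2 e3 e4
    rw [EventuallyEq.deriv_eq e1, e1.self_of_nhds,
      ((hasDerivAt_pow n w).fun_mul e3.differentiableAt.hasDerivAt).deriv]
    simp only [β]
    have : (n : ℂ) * w ^ (n - 1) = n * w ^ n / w := by
      rcases Nat.eq_zero_or_pos n with hn | hn
      · simp [hn]
      · obtain ⟨m, hm⟩ := Nat.exists_eq_succ_of_ne_zero hn.ne'
        rw [hm]; simp only [Nat.succ_eq_add_one, Nat.add_sub_cancel]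
        field_simp
        ring
    rw [this]
    have hwn : w ^ n ≠ 0 := pow_ne_zero n e4
    field_simp
  obtain ⟨s1, s2⟩ := schwarzian_of_deriv_eq hz h4 h3 h1
  have h9 : HasDerivAt (fun w : ℂ => (n : ℂ) / w) (-n / z ^ 2) z :=
    ((hasDerivAt_const z (n : ℂ)).fun_div (hasDerivAt_id' z) hz).congr_deriv (by ring)
  rw [EventuallyEq.deriv_eq hP, (h9.fun_add h6.differentiableAt.hasDerivAt).deriv] at s2
  rw [hP.self_of_nhds] at s1 s2
  rw [s1, s2]
  constructor
  · field_simp; ring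
  · simp only [T]
    field_simp
    ring

theorem localPair_of_simple_pole {F A : ℂ → ℂ} {b : ℂ} (hA : AnalyticAt ℂ A 0)
    (hF : ∀ᶠ z in 𝓝[≠] (0 : ℂ), F z = b * z⁻¹ + A z) (hb : b ≠ 0) : LocalPair F 0 := by
  refine ⟨fun z => b + z * A z, fun z => z, analyticAt_const.add (analyticAt_id.mul hA),
    analyticAt_id, ?_, ?_⟩
  · simpa using hb
  · filter_upwards [hF, self_mem_nhdsWithin] with z h1 h2
    have hz : z ≠ 0 := h2
    refine ⟨hz, ?_⟩
    rw [h1]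
    field_simp

/-- The bound forces `f` and `g` to be locally univalent at infinity too. -/
theorem localPair_zero_of_bound {F G A A' k : ℂ → ℂ} {b b' : ℂ} (hA : AnalyticAt ℂ A 0)
    (hA' : AnalyticAt ℂ A' 0) (hF : ∀ᶠ z in 𝓝[≠] (0 : ℂ), F z = b * z⁻¹ + A z)
    (hG : ∀ᶠ z in 𝓝[≠] (0 : ℂ), G z = b' * z⁻¹ + A' z)
    (hF' : ∀ᶠ z in 𝓝[≠] (0 : ℂ), deriv F z ≠ 0) (hG' : ∀ᶠ z in 𝓝[≠] (0 : ℂ), deriv G z ≠ 0)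
    (hk : AnalyticAt ℂ k 0) (hk0 : k 0 = 1)
    (hbound : ∀ᶠ z in 𝓝[≠] (0 : ℂ), ‖(1 - k z) / k z -
        ((‖z‖ : ℂ) ^ 2 - 1) * (z * deriv k z / k z + (z * preSchwarzian G z + 2)) +
        ((‖z‖ : ℂ) ^ 2 - 1) ^ 2 *
          (k z * ((1 / 2 : ℂ) * z ^ 2 * (schwarzian F z - schwarzian G z)))‖ ≤ ‖z‖ ^ 2) :
    LocalPair F 0 ∧ b' ≠ 0 := by
  obtain ⟨m, φ, β, T, hφ, hφ0, hβ, hT, hT0, hγ, hS⟩ := exists_order_data hA hF hF'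
  obtain ⟨n, φ', β', T', hφ', hφ0', hβ', hT', hT0', hγ', hS'⟩ := exists_order_data hA' hG hG'
  have hkne : k 0 ≠ 0 := by rw [hk0]; exact one_ne_zero
  obtain ⟨h1, h2⟩ := bounds_of_quadratic_bound (A := fun z => (1 - k z) / k z)
    (B := fun z => -(z * deriv k z / k z + (n + z * β' z)))
    (C := fun z => k z * ((1 / 2 : ℂ) * (T z - T' z)))
    ((analyticAt_const.sub hk).div hk hkne)
    (((analyticAt_id.mul hk.deriv).div hk hkne).add
      (analyticAt_const.add (analyticAt_id.mul hβ'))).neg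
    (hk.mul (analyticAt_const.mul (hT.sub hT'))) (by
      filter_upwards [hbound, hS, hS'] with z h1 h2 h3
      rw [h3.1] at h1
      convert h1 using 2
      rw [← h2.2, ← h3.2]
      ring)
  simp only [hk0, hT0, hT0'] at h1 h2
  norm_num at h1 h2
  -- At the origin A = 0, B = -n and C = ½(m - m²/2 - n + n²/2). The first relation gives C = -n,
  -- after which the second reads n ≤ 1.
  have hC : (1 / 2 : ℂ) * (m - m ^ 2 / 2 - (n - n ^ 2 / 2)) = -n := by linear_combination h1
  have hn1 : n ≤ 1 := by
    have e : -(n : ℂ) - 2 * (1 / 2 * (m - m ^ 2 / 2 - (n - n ^ 2 / 2))) = n := by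
      linear_combination -2 * hC
    rw [e] at h2
    simpa using h2
  have hval' : b' = (0 : ℂ) ^ n * φ' 0 := by simpa using hγ'.self_of_nhds
  -- Order 1 is impossible because b' - z²A'' has no linear term.
  have hn0 : n = 0 := by
    by_contra hne
    have hn : n = 1 := by omega
    rw [hn] at hγ' hval'
    simp only [pow_one] at hγ'
    have hd := EventuallyEq.deriv_eq hγ'
    rw [((hasDerivAt_id' (0 : ℂ)).fun_mul hφ'.differentiableAt.hasDerivAt).deriv,
      (((hasDerivAt_pow 2 (0 : ℂ)).fun_mul
        hA'.deriv.differentiableAt.hasDerivAt).const_sub b').deriv] at hd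
    simp at hd
    exact hφ0' hd.symm
  rw [hn0] at hval' hC
  refine ⟨?_, by rw [hval']; simpa using hφ0'⟩
  -- With n = 0 the relation becomes m(m - 2) = 0: either F has a simple pole at the origin, or b =
  -- 0 and F is analytic there with nonzero derivative.
  have hm : m = 0 ∨ m = 2 := by
    have : (m : ℂ) * (m - 2) = 0 := by
      push_cast at hC
      linear_combination -4 * hC
    rcases mul_eq_zero.mp this with h | h
    · left; exact_mod_cast h
    · right
      have : (m : ℂ) = 2 := by linear_combination h
      exact_mod_cast this
  have hval : b = (0 : ℂ) ^ m * φ 0 := by simpa using hγ.self_of_nhds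
  rcases hm with hm | hm
  · rw [hm] at hval
    exact localPair_of_simple_pole hA hF (by rw [hval]; simpa using hφ0)
  · rw [hm] at hval hγ
    have hb : b = 0 := by rw [hval]; ring
    have hd : deriv A 0 = -φ 0 := by
      refine eq_at_of_eventuallyEq_punctured (f := deriv A) (g := fun z => -φ z)
        hA.deriv.continuousAt hφ.continuousAt.neg ?_
      filter_upwards [hγ.filter_mono nhdsWithin_le_nhds, self_mem_nhdsWithin] with z h1 h2
      rw [hb] at h1
      exact mul_left_cancel₀ (pow_ne_zero 2 h2) (by linear_combination -h1)
    refine ⟨A, fun _ => 1, hA, analyticAt_const, ?_, ?_⟩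
    · simpa [hd] using hφ0
    · filter_upwards [hF] with z hz
      simp [hz, hb]

/-! ### Poles, denominators and transfer of the criterion -/

theorem deriv_inv_ne_zero {z : ℂ} (hz : z ≠ 0) : deriv (fun w : ℂ => w⁻¹) z ≠ 0 := by
  rw [deriv_inv]
  exact neg_ne_zero.mpr (inv_ne_zero (pow_ne_zero 2 hz))

theorem meromorphicNFAt_comp_inv {f : ℂ → ℂ} {z : ℂ} (hz : z ≠ 0) (hf : MeromorphicNFAt f z⁻¹) :
    MeromorphicNFAt (fun w => f w⁻¹) z :=
  (meromorphicNFAt_comp_iff_of_deriv_ne_zero (analyticAt_inv hz) (deriv_inv_ne_zero hz)).mpr hf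

theorem isPoleAt_comp_inv {f : ℂ → ℂ} {z : ℂ} (hz : z ≠ 0) :
    IsPoleAt (fun w => f w⁻¹) z ↔ IsPoleAt f z⁻¹ := by
  have := meromorphicOrderAt_comp_of_deriv_ne_zero (f := f) (analyticAt_inv hz)
    (deriv_inv_ne_zero hz)
  rw [IsPoleAt, IsPoleAt, ← this]
  rfl

theorem sphereValue_comp_inv {f : ℂ → ℂ} {z : ℂ} (hz : z ≠ 0) :
    sphereValue (fun w => f w⁻¹) z = sphereValue f z⁻¹ := by
  by_cases h : IsPoleAt f z⁻¹
  · rw [sphereValue, sphereValue, if_pos h, if_pos ((isPoleAt_comp_inv hz).mpr h)]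
  · rw [sphereValue, sphereValue, if_neg h, if_neg (mt (isPoleAt_comp_inv hz).mp h)]

theorem not_isPoleAt_iff_analyticAt {f : ℂ → ℂ} {z : ℂ} (hf : MeromorphicNFAt f z) :
    ¬ IsPoleAt f z ↔ AnalyticAt ℂ f z := by
  rw [IsPoleAt, not_lt, hf.meromorphicOrderAt_nonneg_iff_analyticAt]

section Pair

variable {F a b : ℂ → ℂ} {p : ℂ}

/-- By continuity Fb = a also at p, so a zero of b would be a zero of a, and the Wronskian would
vanish. -/
theorem denominator_ne_zero_of_analyticAt (ha : AnalyticAt ℂ a p) (hb : AnalyticAt ℂ b p)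
    (hW : a p * deriv b p - deriv a p * b p ≠ 0)
    (hF : ∀ᶠ z in 𝓝[≠] p, b z ≠ 0 ∧ F z * b z = a z) (hFa : AnalyticAt ℂ F p) :
    b p ≠ 0 ∧ F p * b p = a p := by
  have h := eq_at_of_eventuallyEq_punctured (hFa.continuousAt.mul hb.continuousAt)
    ha.continuousAt (hF.mono fun z hz => hz.2)
  refine ⟨fun hb0 => hW ?_, h⟩
  have ha0 : a p = 0 := by rw [← h, Pi.mul_apply, hb0, mul_zero]
  rw [ha0, hb0]; ring

theorem isPoleAt_iff_denominator_eq_zero (ha : AnalyticAt ℂ a p) (hb : AnalyticAt ℂ b p)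
    (hW : a p * deriv b p - deriv a p * b p ≠ 0)
    (hF : ∀ᶠ z in 𝓝[≠] p, b z ≠ 0 ∧ F z * b z = a z) (hNF : MeromorphicNFAt F p) :
    IsPoleAt F p ↔ b p = 0 := by
  constructor
  · intro hpole
    by_contra hb0
    have e : F =ᶠ[𝓝[≠] p] a / b := by
      filter_upwards [hF] with z hz
      rw [Pi.div_apply, ← hz.2, mul_div_cancel_right₀ _ hz.1]
    rw [IsPoleAt, meromorphicOrderAt_congr e] at hpole
    exact not_le.mpr hpole (ha.div hb hb0).meromorphicOrderAt_nonneg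
  · intro hb0
    by_contra hpole
    exact (denominator_ne_zero_of_analyticAt ha hb hW hF
      ((not_isPoleAt_iff_analyticAt hNF).mp hpole)).1 hb0

theorem LocalPair.deriv_ne_zero (h : LocalPair F p) (hFa : AnalyticAt ℂ F p) :
    deriv F p ≠ 0 := by
  obtain ⟨a, b, ha, hb, hW, hF⟩ := h
  obtain ⟨hb0, hFp⟩ := denominator_ne_zero_of_analyticAt ha hb hW hF hFa
  have hFe : ∀ᶠ z in 𝓝 p, F z * b z = a z := by
    rw [eventually_nhdsWithin_iff] at hF
    filter_upwards [hF] with z h1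
    by_cases hz : z = p
    · rw [hz, hFp]
    · exact (h1 hz).2
  rw [(preSchwarzian_of_eventuallyEq_div ha hb hb0 hW hFe).1]
  exact div_ne_zero (neg_ne_zero.mpr hW) (pow_ne_zero 2 hb0)

end Pair

/-- A pole of `g` off the origin would make the bounded expression unbounded. -/
theorem analyticAt_of_bound {F G k : ℂ → ℂ} {p : ℂ} (hp0 : p ≠ 0) (hp : ‖p‖ < 1)
    (hF : LocalPair F p) (hG : LocalPair G p) (hNF : MeromorphicNFAt G p)
    (hk : AnalyticAt ℂ k p) (hkp : k p ≠ 0)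
    (hbound : ∀ᶠ z in 𝓝[≠] p, ‖(1 - k z) / k z -
        ((‖z‖ : ℂ) ^ 2 - 1) * (z * deriv k z / k z + (z * preSchwarzian G z + 2)) +
        ((‖z‖ : ℂ) ^ 2 - 1) ^ 2 *
          (k z * ((1 / 2 : ℂ) * z ^ 2 * (schwarzian F z - schwarzian G z)))‖ ≤ ‖z‖ ^ 2) :
    AnalyticAt ℂ G p := by
  obtain ⟨S, hS, hFS⟩ := hF.exists_analyticAt_schwarzian
  obtain ⟨T, hT, hGT⟩ := hG.exists_analyticAt_schwarzian
  obtain ⟨a, b, ha, hb, hW, hab⟩ := hG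
  rw [← not_isPoleAt_iff_analyticAt hNF, isPoleAt_iff_denominator_eq_zero ha hb hW hab hNF]
  intro hb0
  let Wr : ℂ → ℂ := fun z => a z * deriv b z - deriv a z * b z
  have hWa : AnalyticAt ℂ Wr p := (ha.mul hb.deriv).sub (ha.deriv.mul hb)
  let N : ℂ → ℂ := fun z => a z * deriv (deriv b) z - deriv (deriv a) z * b z
  have hN : AnalyticAt ℂ N p := (ha.mul hb.deriv.deriv).sub (ha.deriv.deriv.mul hb)
  -- The bounded expression times b, with the pole of G''/G' cleared. It must tend to 0 with b, yet
  -- its value at p is 2p(|p|² - 1)b'(p), which is nonzero.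
  let u : ℂ → ℂ := fun z => b z * ((1 - k z) / k z) -
        ((‖z‖ : ℂ) ^ 2 - 1) * (b z * (z * deriv k z / k z) +
          (z * (b z * (N z / Wr z) - 2 * deriv b z) + 2 * b z)) +
        ((‖z‖ : ℂ) ^ 2 - 1) ^ 2 *
          (b z * (k z * ((1 / 2 : ℂ) * z ^ 2 * (S z - T z))))
  have huc : ContinuousAt u p := by
    have h1 := hb.continuousAt
    have h2 := hk.continuousAt
    have h3 := hk.deriv.continuousAt
    have h4 : ContinuousAt (fun z => N z / Wr z) p := (hN.div hWa hW).continuousAt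
    have h5 := hb.deriv.continuousAt
    have h6 := hS.continuousAt
    have h7 := hT.continuousAt
    have h8 : ContinuousAt (fun z => (1 - k z) / k z) p := (continuousAt_const.sub h2).div h2 hkp
    have h9 : ContinuousAt (fun z => z * deriv k z / k z) p :=
      (continuousAt_id.mul h3).div h2 hkp
    fun_prop
  have hle : ∀ᶠ z in 𝓝[≠] p, ‖u z‖ ≤ ‖b z‖ * ‖z‖ ^ 2 := by
    filter_upwards [hbound, hFS, hGT, hab, eventually_eventually_nhdsWithin.mpr hab,
      self_mem_nhdsWithin, ha.eventually_analyticAt.filter_mono nhdsWithin_le_nhds,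
      hb.eventually_analyticAt.filter_mono nhdsWithin_le_nhds,
      (hWa.continuousAt.eventually_ne hW).filter_mono nhdsWithin_le_nhds]
      with z h1 h2 h3 h4 h5 h6 h7 h8 h9
    rw [isOpen_compl_singleton.nhdsWithin_eq h6] at h5
    have hP := (preSchwarzian_of_eventuallyEq_div h7 h8 h4.1 h9 (h5.mono fun w hw => hw.2)).2
    rw [h2, h3, hP] at h1
    have hu : u z = b z * ((1 - k z) / k z -
        ((‖z‖ : ℂ) ^ 2 - 1) * (z * deriv k z / k z + (z * (N z / Wr z - 2 * deriv b z / b z) + 2)) +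
        ((‖z‖ : ℂ) ^ 2 - 1) ^ 2 * (k z * ((1 / 2 : ℂ) * z ^ 2 * (S z - T z)))) := by
      have : b z * (2 * deriv b z / b z) = 2 * deriv b z := mul_div_cancel₀ _ h4.1
      simp only [u]
      linear_combination (-((‖z‖ : ℂ) ^ 2 - 1) * z) * this
    rw [hu, norm_mul]
    exact mul_le_mul_of_nonneg_left h1 (norm_nonneg _)
  have hlim := le_of_tendsto_of_tendsto (huc.norm.tendsto.mono_left nhdsWithin_le_nhds)
    (((hb.continuousAt.norm.mul (continuous_norm.pow 2).continuousAt).tendsto).mono_left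
      nhdsWithin_le_nhds) hle
  have hup : u p = ((‖p‖ : ℂ) ^ 2 - 1) * (2 * p * deriv b p) := by
    simp only [u, hb0]; ring
  have hdb : deriv b p ≠ 0 := by
    intro h; apply hW; rw [h, hb0]; ring
  have hσ : (‖p‖ : ℂ) ^ 2 - 1 ≠ 0 := by
    have : ‖p‖ ^ 2 - 1 ≠ 0 := by nlinarith [norm_nonneg p]
    exact_mod_cast this
  have : u p ≠ 0 := by
    rw [hup]
    exact mul_ne_zero hσ (mul_ne_zero (mul_ne_zero two_ne_zero hp0) hdb)
  apply this
  rw [← norm_le_zero_iff]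
  simpa [hb0] using hlim

/-- The criterion, rewritten in the coordinate `z = 1 / ζ`. -/
theorem bound_comp_inv {f g h : ℂ → ℂ} {z : ℂ} (hz : z ≠ 0) (hf : AnalyticAt ℂ f z⁻¹)
    (hf' : deriv f z⁻¹ ≠ 0) (hg : AnalyticAt ℂ g z⁻¹) (hg' : deriv g z⁻¹ ≠ 0)
    {k : ℂ → ℂ} (hk : k z = h z⁻¹) (hk' : deriv k z = -deriv h z⁻¹ / z ^ 2)
    (hineq : ‖(1 - h z⁻¹) / h z⁻¹ * (‖z⁻¹‖ : ℂ) ^ 2 - ((‖z⁻¹‖ : ℂ) ^ 2 - 1) *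
            (z⁻¹ * deriv h z⁻¹ / h z⁻¹ + z⁻¹ * deriv (deriv g) z⁻¹ / deriv g z⁻¹)
          + (1 / 2 : ℂ) * ((‖z⁻¹‖ : ℂ) ^ 2 - 1) ^ 2 * (z⁻¹ / (starRingEnd ℂ) z⁻¹) * h z⁻¹ *
            (schwarzian f z⁻¹ - schwarzian g z⁻¹)‖ ≤ 1) :
    ‖(1 - k z) / k z - ((‖z‖ : ℂ) ^ 2 - 1) *
        (z * deriv k z / k z + (z * preSchwarzian (fun w => g w⁻¹) z + 2)) +
        ((‖z‖ : ℂ) ^ 2 - 1) ^ 2 * (k z * ((1 / 2 : ℂ) * z ^ 2 *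
          (schwarzian (fun w => f w⁻¹) z - schwarzian (fun w => g w⁻¹) z)))‖ ≤ ‖z‖ ^ 2 := by
  rw [(schwarzian_comp_inv hz hf hf').2, (schwarzian_comp_inv hz hg hg').2,
    (schwarzian_comp_inv hz hg hg').1, hk', hk]
  set H := (h z⁻¹)⁻¹ with hH
  have hn : (‖z‖ : ℂ) ≠ 0 := by simpa using hz
  have hc : (starRingEnd ℂ) z = (‖z‖ : ℂ) ^ 2 / z := by
    rw [eq_div_iff hz, mul_comm, Complex.mul_conj, Complex.normSq_eq_norm_sq]
    push_cast; rfl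
  rw [norm_inv, map_inv₀, hc, mul_div_assoc z⁻¹ (deriv (deriv g) z⁻¹)] at hineq
  change ‖_ - _ * (_ + z⁻¹ * preSchwarzian g z⁻¹) + _‖ ≤ 1 at hineq
  simp only [div_eq_mul_inv (_) (h z⁻¹), ← hH] at hineq ⊢
  -- With conj z = |z|²/z, the expression in z is exactly |z|² times the one in ζ.
  have e : (1 - h z⁻¹) * H - ((‖z‖ : ℂ) ^ 2 - 1) *
        (z * (-deriv h z⁻¹ / z ^ 2) * H + (z * (-preSchwarzian g z⁻¹ / z ^ 2 - 2 / z) + 2)) +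
        ((‖z‖ : ℂ) ^ 2 - 1) ^ 2 * (h z⁻¹ * ((1 / 2 : ℂ) * z ^ 2 *
          (schwarzian f z⁻¹ / z ^ 4 - schwarzian g z⁻¹ / z ^ 4))) = (‖z‖ : ℂ) ^ 2 *
      ((1 - h z⁻¹) * H * ((‖z‖⁻¹ : ℝ) : ℂ) ^ 2 - (((‖z‖⁻¹ : ℝ) : ℂ) ^ 2 - 1) *
            (z⁻¹ * deriv h z⁻¹ * H + z⁻¹ * preSchwarzian g z⁻¹)
          + (1 / 2 : ℂ) * (((‖z‖⁻¹ : ℝ) : ℂ) ^ 2 - 1) ^ 2 *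
            (z⁻¹ / ((‖z‖ : ℂ) ^ 2 / z)⁻¹) * h z⁻¹ *
            (schwarzian f z⁻¹ - schwarzian g z⁻¹)) := by
    push_cast
    field_simp
    ring
  rw [e, norm_mul, norm_pow, Complex.norm_real, norm_norm]
  exact mul_le_of_le_one_right (by positivity) hineq

/-! ### Functions of class Σ in the disc, and the conclusion -/

theorem inv_mem_exteriorDisk {z : ℂ} (hz0 : z ≠ 0) (hz : ‖z‖ < 1) : z⁻¹ ∈ exteriorDisk := by
  change 1 < ‖z⁻¹‖
  rw [norm_inv]
  exact (one_lt_inv₀ (norm_pos_iff.mpr hz0)).mpr hz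

/-- The normal form of a function of class `Σ` in the coordinate `z = 1 / ζ`. -/
theorem ClassSigma.comp_inv {f : ℂ → ℂ} (hf : ClassSigma f)
    (hloc : LocallyUnivalentOn f exteriorDisk) :
    (∃ (b : ℂ) (A : ℂ → ℂ), AnalyticAt ℂ A 0 ∧
      ∀ᶠ z in 𝓝[≠] (0 : ℂ), f z⁻¹ = b * z⁻¹ + A z) ∧
    ∀ p, p ≠ 0 → ‖p‖ < 1 → LocalPair (fun z => f z⁻¹) p ∧
      MeromorphicNFAt (fun z => f z⁻¹) p ∧ LocalPair f p⁻¹ ∧ MeromorphicNFAt f p⁻¹ := by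
  obtain ⟨hNF, b, c, hc⟩ := hf
  constructor
  · obtain ⟨A, hA, -, -, h⟩ := exists_analyticAt_of_hasSum hc
    exact ⟨b, A, hA, h.mono fun z hz => by rw [← hz]; ring⟩
  · intro p hp0 hp
    have hmem := inv_mem_exteriorDisk hp0 hp
    obtain ⟨V, hVo, hpV, hV⟩ := hloc _ hmem
    have h1 := localPair_of_univalentOn (hNF hmem) (hVo.mem_nhds hpV) hV
    exact ⟨h1.comp_inv hp0, meromorphicNFAt_comp_inv hp0 (hNF hmem), h1, hNF hmem⟩

theorem analyticAt_of_comp_inv {f : ℂ → ℂ} {z : ℂ} (hz : z ≠ 0)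
    (hf : AnalyticAt ℂ (fun w => f w⁻¹) z) : AnalyticAt ℂ f z⁻¹ :=
  (analyticAt_comp_iff_of_deriv_ne_zero (analyticAt_inv hz) (deriv_inv_ne_zero hz)).mp hf

theorem eventually_analyticAt_of_simple_pole {F A : ℂ → ℂ} {b : ℂ} (hA : AnalyticAt ℂ A 0)
    (hF : ∀ᶠ z in 𝓝[≠] (0 : ℂ), F z = b * z⁻¹ + A z) :
    ∀ᶠ z in 𝓝[≠] (0 : ℂ), AnalyticAt ℂ F z ∧ -z ^ 2 * deriv F z = b - z ^ 2 * deriv A z := by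
  filter_upwards [eventually_eventually_nhdsWithin.mpr hF, self_mem_nhdsWithin,
    hA.eventually_analyticAt.filter_mono nhdsWithin_le_nhds] with z h1 h2 h3
  rw [isOpen_compl_singleton.nhdsWithin_eq h2] at h1
  have hz : z ≠ 0 := h2
  constructor
  · exact ((analyticAt_const.mul (analyticAt_inv hz)).add h3).congr (h1.mono fun w hw => hw.symm)
  · rw [EventuallyEq.deriv_eq h1, (((hasDerivAt_inv hz).const_mul b).fun_add
      h3.differentiableAt.hasDerivAt).deriv]
    field_simp
    ring

/-- A function analytic off the origin which agrees there with an analytic germ extends. -/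
theorem analyticOnNhd_ite {φ A : ℂ → ℂ} {c : ℂ} (hA : AnalyticAt ℂ A 0) (hc : A 0 = c)
    (h : ∀ᶠ z in 𝓝[≠] (0 : ℂ), φ z = A z)
    (hφ : ∀ z, z ≠ 0 → ‖z‖ < 1 → AnalyticAt ℂ φ z) :
    AnalyticOnNhd ℂ (fun z => if z = 0 then c else φ z) (Metric.ball 0 1) ∧
      deriv (fun z => if z = 0 then c else φ z) 0 = deriv A 0 := by
  have e : (fun z => if z = 0 then c else φ z) =ᶠ[𝓝 0] A := by
    rw [eventually_nhdsWithin_iff] at h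
    filter_upwards [h] with z hz
    by_cases h0 : z = 0
    · rw [if_pos h0, h0, hc]
    · rw [if_neg h0, hz h0]
  refine ⟨fun z hz => ?_, e.deriv_eq⟩
  by_cases h0 : z = 0
  · rw [h0]; exact hA.congr e.symm
  · refine (hφ z h0 (by simpa using hz)).congr ?_
    filter_upwards [eventually_ne_nhds h0] with w hw
    rw [if_neg hw]

theorem corollaryc2 (f g h : ℂ → ℂ)
    (hf : ClassSigma f) (hg : ClassSigma g)
    (hf_loc : LocallyUnivalentOn f exteriorDisk) (hg_loc : LocallyUnivalentOn g exteriorDisk)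
    (hh : AnalyticOnNhd ℂ h exteriorDisk)
    (hh_re : ∀ ζ ∈ exteriorDisk, 1 / 2 ≤ (h ζ).re)
    (hh_exp : HasUnitExpansion h)
    (hineq : ∀ ζ ∈ exteriorDisk, ¬ IsPoleAt f ζ → ¬ IsPoleAt g ζ →
      ‖(1 - h ζ) / h ζ * (‖ζ‖ : ℂ) ^ 2
          - ((‖ζ‖ : ℂ) ^ 2 - 1) *
            (ζ * deriv h ζ / h ζ + ζ * deriv (deriv g) ζ / deriv g ζ)
          + (1 / 2 : ℂ) * ((‖ζ‖ : ℂ) ^ 2 - 1) ^ 2 * (ζ / (starRingEnd ℂ) ζ) * h ζ *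
            (schwarzian f ζ - schwarzian g ζ)‖ ≤ 1) :
    UnivalentOn f exteriorDisk := by
  obtain ⟨⟨b, A, hA, hFA⟩, hfp⟩ := hf.comp_inv hf_loc
  obtain ⟨⟨b', A', hA', hGA⟩, hgp⟩ := hg.comp_inv hg_loc
  obtain ⟨c, hc0, hc1, hc⟩ := hh_exp
  obtain ⟨H, hH, hH0, hH1, hhH⟩ := exists_analyticAt_of_hasSum hc
  rw [hc0] at hH0
  rw [hc1] at hH1
  set F : ℂ → ℂ := fun z => f z⁻¹ with hFdef
  set G : ℂ → ℂ := fun z => g z⁻¹ with hGdef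
  let k : ℂ → ℂ := fun z => if z = 0 then 1 else h z⁻¹
  obtain ⟨hk, hk1⟩ : AnalyticOnNhd ℂ k (Metric.ball 0 1) ∧ deriv k 0 = deriv H 0 :=
    analyticOnNhd_ite hH hH0 hhH fun z hz0 hz =>
      (hh _ (inv_mem_exteriorDisk hz0 hz)).comp_of_eq (analyticAt_inv hz0) rfl
  have hkh : ∀ z, z ≠ 0 → k z = h z⁻¹ := fun z hz => if_neg hz
  have hkh' : ∀ z, z ≠ 0 → ‖z‖ < 1 → deriv k z = -deriv h z⁻¹ / z ^ 2 := by
    intro z hz0 hz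
    have e : k =ᶠ[𝓝 z] fun w => h w⁻¹ := (eventually_ne_nhds hz0).mono hkh
    rw [e.deriv_eq]
    exact (((hh _ (inv_mem_exteriorDisk hz0 hz)).differentiableAt.hasDerivAt.comp z
      (hasDerivAt_inv hz0)).congr_deriv (by ring)).deriv
  have hk0 : k 0 = 1 := if_pos rfl
  have hkne : ∀ z, ‖z‖ < 1 → k z ≠ 0 := by
    intro z hz h0
    by_cases hz0 : z = 0
    · rw [hz0, hk0] at h0; exact one_ne_zero h0
    · rw [hkh z hz0] at h0
      have := hh_re _ (inv_mem_exteriorDisk hz0 hz)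
      rw [h0] at this
      norm_num at this
  have hbound : ∀ z, ‖z‖ < 1 → z ≠ 0 → AnalyticAt ℂ F z → AnalyticAt ℂ G z →
      ‖(1 - k z) / k z -
        ((‖z‖ : ℂ) ^ 2 - 1) * (z * deriv k z / k z + (z * preSchwarzian G z + 2)) +
        ((‖z‖ : ℂ) ^ 2 - 1) ^ 2 *
          (k z * ((1 / 2 : ℂ) * z ^ 2 * (schwarzian F z - schwarzian G z)))‖ ≤ ‖z‖ ^ 2 := by
    intro z hz hz0 hFz hGz
    have hfz := analyticAt_of_comp_inv hz0 hFz
    have hgz := analyticAt_of_comp_inv hz0 hGz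
    obtain ⟨-, -, hf3, hf4⟩ := hfp z hz0 hz
    obtain ⟨-, -, hg3, hg4⟩ := hgp z hz0 hz
    exact bound_comp_inv hz0 hfz (hf3.deriv_ne_zero hfz) hgz (hg3.deriv_ne_zero hgz) (hkh z hz0)
      (hkh' z hz0 hz) (hineq _ (inv_mem_exteriorDisk hz0 hz)
        ((not_isPoleAt_iff_analyticAt hf4).mpr hfz) ((not_isPoleAt_iff_analyticAt hg4).mpr hgz))
  have hball : ∀ p : ℂ, ‖p‖ < 1 → ∀ᶠ z in 𝓝 p, ‖z‖ < 1 := fun p hp =>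
    continuous_norm.continuousAt.eventually_lt continuousAt_const hp
  have hGan : ∀ p, ‖p‖ < 1 → p ≠ 0 → AnalyticAt ℂ G p := by
    intro p hp hp0
    obtain ⟨hF1, -, -, -⟩ := hfp p hp0 hp
    obtain ⟨hG1, hG2, -, -⟩ := hgp p hp0 hp
    refine analyticAt_of_bound hp0 hp hF1 hG1 hG2 (hk p (by simpa using hp)) (hkne p hp) ?_
    filter_upwards [hF1.eventually_analyticAt, hG1.eventually_analyticAt,
      (hball p hp).filter_mono nhdsWithin_le_nhds,
      (eventually_ne_nhds hp0).filter_mono nhdsWithin_le_nhds] with z h1 h2 h3 h4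
    exact hbound z h3 h4 h1 h2
  have hball0 : ∀ᶠ z in 𝓝[≠] (0 : ℂ), z ≠ 0 ∧ ‖z‖ < 1 := by
    filter_upwards [self_mem_nhdsWithin,
      (hball 0 (by simp)).filter_mono nhdsWithin_le_nhds] with z h1 h2
    exact ⟨h1, h2⟩
  have hFan0 := eventually_analyticAt_of_simple_pole hA hFA
  have hGan0 := eventually_analyticAt_of_simple_pole hA' hGA
  obtain ⟨hF0, hb'⟩ := localPair_zero_of_bound hA hA' hFA hGA
    (by
      filter_upwards [hball0, hFan0] with z h1 h2
      exact (hfp z h1.1 h1.2).1.deriv_ne_zero h2.1)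
    (by
      filter_upwards [hball0, hGan0] with z h1 h2
      exact (hgp z h1.1 h1.2).1.deriv_ne_zero h2.1)
    (hk 0 (by simp)) hk0 (by
      filter_upwards [hball0, hFan0, hGan0] with z h1 h2 h3
      exact hbound z h1.2 h1.1 h2.1 h3.1)
  -- The value b' fills in the limit of -z²G' at 0. Near 0 this function is b' - z²A'', whence γ'(0)
  -- = 0.
  let γ : ℂ → ℂ := fun z => if z = 0 then b' else -z ^ 2 * deriv G z
  obtain ⟨hγ, hγ1⟩ : AnalyticOnNhd ℂ γ (Metric.ball 0 1) ∧
      deriv γ 0 = deriv (fun z => b' - z ^ 2 * deriv A' z) 0 :=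
    analyticOnNhd_ite (analyticAt_const.sub ((analyticAt_id.pow 2).mul hA'.deriv)) (by simp)
      (hGan0.mono fun z hz => hz.2)
      fun z hz0 hz => (analyticAt_id.pow 2).neg.mul (hGan z hz hz0).deriv
  rw [(((hasDerivAt_pow 2 (0 : ℂ)).fun_mul
    hA'.deriv.differentiableAt.hasDerivAt).const_sub b').deriv] at hγ1
  have hγG : ∀ z, ‖z‖ < 1 → z ≠ 0 → γ z = -z ^ 2 * deriv G z := fun z _ hz => if_neg hz
  have hγne : ∀ z, ‖z‖ < 1 → γ z ≠ 0 := by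
    intro z hz
    by_cases hz0 : z = 0
    · rw [hz0]; simpa [γ] using hb'
    · rw [hγG z hz hz0]
      exact mul_ne_zero (neg_ne_zero.mpr (pow_ne_zero 2 hz0))
        ((hgp z hz0 hz).1.deriv_ne_zero (hGan z hz hz0))
  have hFL : ∀ p, ‖p‖ < 1 → LocalPair F p := fun p hp => by
    by_cases hp0 : p = 0
    · rw [hp0]; exact hF0
    · exact (hfp p hp0 hp).1
  have hGL : ∀ p, ‖p‖ < 1 → LocalPair G p := fun p hp => by
    by_cases hp0 : p = 0
    · rw [hp0]; exact localPair_of_simple_pole hA' hGA hb'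
    · exact (hgp p hp0 hp).1
  have hlt : ∀ ζ ∈ exteriorDisk, ‖ζ⁻¹‖ < 1 ∧ ζ⁻¹ ≠ 0 := by
    intro ζ hζ
    have hζ' : 1 < ‖ζ‖ := hζ
    exact ⟨by rw [norm_inv]; exact inv_lt_one_of_one_lt₀ hζ',
      inv_ne_zero (norm_pos_iff.mp (zero_lt_one.trans hζ'))⟩
  intro x hx y hy hxy
  obtain ⟨hx1, hx0⟩ := hlt x hx
  obtain ⟨hy1, hy0⟩ := hlt y hy
  -- A radius below 1 that captures both points: the closed disc then stays in the domain and
  -- contains finitely many poles of F.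
  obtain ⟨ρ, hρ, hρ1⟩ := exists_between (max_lt hx1 hy1)
  obtain ⟨hxρ, hyρ⟩ := max_lt_iff.mp hρ
  obtain ⟨a, d, ha, hd, hW, had, hinj⟩ := exists_injective_pair hFL hGL hGan hk hγ hk0
    (by rw [hk1, hH1]) (by rw [hγ1]; simp) hkne hγne hγG hbound
    ((norm_nonneg _).trans_lt hxρ) hρ1
  have hxm : x⁻¹ ∈ Metric.ball (0 : ℂ) ρ := by simpa using hxρ
  have hym : y⁻¹ ∈ Metric.ball (0 : ℂ) ρ := by simpa using hyρ
  refine inv_injective (hinj _ hxm _ hym ?_)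
  have hpole : ∀ z ∈ Metric.ball (0 : ℂ) ρ, ‖z‖ < 1 → z ≠ 0 →
      (IsPoleAt F z ↔ d z = 0) ∧ (¬ IsPoleAt F z → F z * d z = a z) := by
    intro z hz hz1 hz0
    have hNF := (hfp z hz0 hz1).2.1
    exact ⟨isPoleAt_iff_denominator_eq_zero (ha z hz) (hd z hz) (hW z hz) (had z hz) hNF,
      fun hp => (denominator_ne_zero_of_analyticAt (ha z hz) (hd z hz) (hW z hz) (had z hz)
        ((not_isPoleAt_iff_analyticAt hNF).mp hp)).2⟩
  obtain ⟨px, vx⟩ := hpole _ hxm hx1 hx0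
  obtain ⟨py, vy⟩ := hpole _ hym hy1 hy0
  rw [← inv_inv x, ← inv_inv y, ← sphereValue_comp_inv hx0, ← sphereValue_comp_inv hy0] at hxy
  change sphereValue F x⁻¹ = sphereValue F y⁻¹ at hxy
  by_cases hpx : IsPoleAt F x⁻¹ <;> by_cases hpy : IsPoleAt F y⁻¹
  · rw [px.mp hpx, py.mp hpy]; ring
  · rw [sphereValue, sphereValue, if_pos hpx, if_neg hpy] at hxy
    exact absurd hxy (OnePoint.infty_ne_coe _)
  · rw [sphereValue, sphereValue, if_neg hpx, if_pos hpy] at hxy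
    exact absurd hxy (OnePoint.coe_ne_infty _)
  · rw [sphereValue, sphereValue, if_neg hpx, if_neg hpy, OnePoint.coe_eq_coe] at hxy
    rw [← vx hpx, ← vy hpy, hxy]; ring
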